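/- For an integer $x$ and a positive integer $n$ let $x \bmod n$ denote the residue of $x$ in $\{0,1,\dots,n-1\}$. Let $n,s,t$ be integers with $1\le s,t<n$, $\gcd(n,s)=1$ and $t\ne n/2$. Suppose that for every integer $p$ with $\gcd(p,n)=1$ we have $$\frac n2 < (ps \bmod n)+(pt \bmod n) < \frac{3n}2 .$$ Then at least one of the following holds: $n\le 78$; $s+t=n$; $s+2t\equiv 0 \pmod n$, that is, $s+2t\in\{n,2n\}$; $2s+t\equiv 0\pmod n$, that is, $2s+t\in\{n,2n\}$; or $n$ is even and $|t-s|=n/2$. -/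

import Mathlib

/-! Replacing p by p times the inverse of s reduces to s = 1, with t replaced by the residue τ of
t/s. The hypothesis is violated by any point (x, y) of the lattice y ≡ τx mod n in the triangle x, y
≥ 0, 2(x + y) ≤ n with x prime to n. Such a point exists unless τ is exceptional
(`exists_point_or_exceptional`).

Thue's lemma gives a primitive lattice vector (a, c) with a², c² ≤ n, and the lattice splits into
rows ay − cx = nj. Along a row x = ai + βj with β prime to a. The set K of primes of n dividing a is
harmless if none of them divides j, so j is taken to be ± a power of q, the least prime outside K.
The other primes of n are sieved in i: among any L consecutive i one is good. If (2qL + 2)² ≤ n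
(`LeastPrimeNotMem.exists_window`), some row has a good point in the triangle. This can fail only
for |a|, |c| ≤ 2, and those vectors make τ exceptional (`exists_point_in_triangle`).

The inequality on L comes from explicit thresholds when n has at most 5 primes, from primorials for
6 to 9 primes, and from Legendre's sieve for 10 or more. The finitely many n > 78 below the
thresholds are checked by computation (`sieveRange_or_checkModulus`). -/

/-! ### Sieving linear functions on short windows. -/

/-- `Sieved S L`: every linear function `a * i + b` whose slope is divisible by no `p ∈ S` takes,
among any `L` consecutive arguments, a value divisible by no `p ∈ S`. -/
def Sieved (S : Finset ℕ) (L : ℕ) : Prop :=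
  ∀ a b : ℤ, (∀ p ∈ S, ¬ (p : ℤ) ∣ a) → ∀ i₀ : ℤ,
    ∃ i, i₀ ≤ i ∧ i < i₀ + L ∧ ∀ p ∈ S, ¬ (p : ℤ) ∣ a * i + b

theorem exists_dvd_mul_add {p : ℕ} (hp : p.Prime) {a : ℤ} (b : ℤ) (ha : ¬ (p : ℤ) ∣ a) (i₀ : ℤ) :
    ∃ v, i₀ ≤ v ∧ v < i₀ + p ∧ (p : ℤ) ∣ a * v + b := by
  have hp0 : (0 : ℤ) < p := by exact_mod_cast hp.pos
  obtain ⟨u, w, huw⟩ : IsCoprime (p : ℤ) a := (Nat.prime_iff_prime_int.1 hp).coprime_iff_not_dvd.2 ha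
  refine ⟨i₀ + (-b * w - i₀) % p, ?_, ?_, ?_⟩
  · have := Int.emod_nonneg (-b * w - i₀) hp0.ne'
    omega
  · have := Int.emod_lt_of_pos (-b * w - i₀) hp0
    omega
  · have h := Int.mul_ediv_add_emod (-b * w - i₀) p
    refine ⟨u * b - a * ((-b * w - i₀) / p), ?_⟩
    have h2 : (-b * w - i₀) % p = (-b * w - i₀) - p * ((-b * w - i₀) / p) := by linarith
    rw [h2]
    linear_combination (-b) * huw

theorem exists_residue_progression {p : ℕ} (hp : p.Prime) {a : ℤ} (b : ℤ) (ha : ¬ (p : ℤ) ∣ a)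
    (i₀ : ℤ) (L : ℕ) :
    ∃ (v : ℤ) (L' : ℕ), L < p * L' + p ∧ p * L' < L + p ∧
      ∀ i, (i₀ ≤ i ∧ i < i₀ + L ∧ (p : ℤ) ∣ a * i + b) ↔
        ∃ i', 0 ≤ i' ∧ i' < (L' : ℤ) ∧ i = v + p * i' := by
  have hp0 : (0 : ℤ) < p := by exact_mod_cast hp.pos
  obtain ⟨v, hv0, hv1, hv2⟩ := exists_dvd_mul_add hp b ha i₀
  have h1 := Int.mul_ediv_add_emod (i₀ + L - v + p - 1) p
  have h2 := Int.emod_nonneg (i₀ + L - v + p - 1) hp0.ne'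
  have h3 := Int.emod_lt_of_pos (i₀ + L - v + p - 1) hp0
  have h4 : 0 ≤ (i₀ + L - v + p - 1) / p := Int.ediv_nonneg (by omega) hp0.le
  obtain ⟨L', hL'⟩ := Int.eq_ofNat_of_zero_le h4
  rw [hL'] at h1
  refine ⟨v, L', ?_, ?_, fun i => ⟨?_, ?_⟩⟩
  · zify; linarith
  · zify; linarith
  · rintro ⟨hi0, hi1, hi2⟩
    have hd : (p : ℤ) ∣ i - v := by
      have : (p : ℤ) ∣ a * (i - v) := by
        have e : a * (i - v) = (a * i + b) - (a * v + b) := by ring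
        exact e ▸ dvd_sub hi2 hv2
      exact ((Nat.prime_iff_prime_int.1 hp).dvd_or_dvd this).resolve_left ha
    obtain ⟨e, he⟩ := hd
    refine ⟨e, ?_, ?_, by linarith⟩
    · by_contra! hlt
      nlinarith
    · by_contra! hle
      nlinarith
  · rintro ⟨e, he0, he1, rfl⟩
    refine ⟨by nlinarith, by nlinarith, ?_⟩
    have : a * (v + p * e) + b = (a * v + b) + p * (a * e) := by ring
    rw [this]
    exact dvd_add hv2 (dvd_mul_right _ _)

theorem card_residue_le {p : ℕ} (hp : p.Prime) {a : ℤ} (b : ℤ) (ha : ¬ (p : ℤ) ∣ a)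
    (i₀ : ℤ) (L : ℕ) :
    ((Finset.Ico i₀ (i₀ + L)).filter fun i => (p : ℤ) ∣ a * i + b).card ≤ (L + p - 1) / p := by
  obtain ⟨v, L', -, h2, h3⟩ := exists_residue_progression hp b ha i₀ L
  have hsub : ((Finset.Ico i₀ (i₀ + L)).filter fun i => (p : ℤ) ∣ a * i + b) ⊆
      (Finset.Ico (0 : ℤ) L').image fun e => v + p * e := by
    intro i hi
    simp only [Finset.mem_filter, Finset.mem_Ico] at hi
    obtain ⟨e, he0, he1, rfl⟩ := (h3 i).1 ⟨hi.1.1, hi.1.2, hi.2⟩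
    exact Finset.mem_image.2 ⟨e, Finset.mem_Ico.2 ⟨he0, he1⟩, rfl⟩
  refine (Finset.card_le_card hsub).trans (Finset.card_image_le.trans ?_)
  rw [Int.card_Ico, sub_zero, Int.toNat_natCast, Nat.le_div_iff_mul_le hp.pos]
  have := hp.pos
  have : L' * p = p * L' := mul_comm _ _
  omega

theorem Sieved.mono {S : Finset ℕ} {L L' : ℕ} (h : Sieved S L) (hL : L ≤ L') : Sieved S L' := by
  intro a b ha i₀
  obtain ⟨i, h1, h2, h3⟩ := h a b ha i₀
  exact ⟨i, h1, by omega, h3⟩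

/-- Counting the arguments removed by each prime separately. -/
theorem sieved_of_sum_lt {S : Finset ℕ} (hS : ∀ p ∈ S, p.Prime) {w : ℕ}
    (h : ∑ p ∈ S, (w + p - 1) / p < w) : Sieved S w := by
  intro a b ha i₀
  by_contra! hcon
  have hsub : Finset.Ico i₀ (i₀ + w) ⊆
      S.biUnion fun p => (Finset.Ico i₀ (i₀ + w)).filter fun i => (p : ℤ) ∣ a * i + b := by
    intro i hi
    have hi' := Finset.mem_Ico.1 hi
    obtain ⟨p, hp, hd⟩ := hcon i hi'.1 hi'.2
    exact Finset.mem_biUnion.2 ⟨p, hp, Finset.mem_filter.2 ⟨hi, hd⟩⟩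
  have h1 := (Finset.card_le_card hsub).trans Finset.card_biUnion_le
  have h2 : ∑ p ∈ S, ((Finset.Ico i₀ (i₀ + w)).filter fun i => (p : ℤ) ∣ a * i + b).card ≤
      ∑ p ∈ S, (w + p - 1) / p :=
    Finset.sum_le_sum fun p hp => card_residue_le (hS p hp) b (ha p hp) i₀ w
  rw [Int.card_Ico] at h1
  have : (i₀ + (w : ℤ) - i₀).toNat = w := by simp
  omega

/-- If only the members of `E` can remove more than one argument, the total is controlled by the
number of primes and the excess over `E`. -/
theorem sieved_of_excess {S E : Finset ℕ} (hS : ∀ p ∈ S, p.Prime) {w : ℕ}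
    (hE : ∀ p ∈ S, p ∉ E → w ≤ p)
    (h : S.card + ∑ p ∈ E, ((w + p - 1) / p - 1) < w) : Sieved S w := by
  refine sieved_of_sum_lt hS (lt_of_le_of_lt ?_ h)
  have h1 : ∀ p ∈ S, (w + p - 1) / p ≤ 1 + if p ∈ E then (w + p - 1) / p - 1 else 0 := by
    intro p hp
    split_ifs with hpE
    · omega
    · have := hE p hp hpE
      have hp0 := (hS p hp).pos
      rw [add_zero, ← Nat.lt_succ_iff, Nat.div_lt_iff_lt_mul hp0]
      omega
  refine (Finset.sum_le_sum h1).trans ?_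
  rw [Finset.sum_add_distrib, Finset.sum_const, smul_eq_mul, mul_one, ← Finset.sum_filter]
  refine Nat.add_le_add_left (Finset.sum_le_sum_of_subset ?_) _
  intro p hp
  exact (Finset.mem_filter.1 hp).2

/-- On the class mod r where the value is 1 mod r, r divides no value. The arguments there advance
by r, so the new slope ar is still prime to S and w steps occupy length rw. For r = 2, 3 this can
beat counting, which loses too many arguments to them. -/
theorem Sieved.insert {S : Finset ℕ} (hS : ∀ p ∈ S, p.Prime) {r w : ℕ} (hr : r.Prime)
    (hrS : r ∉ S) (h : Sieved S w) : Sieved (insert r S) (r * w) := by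
  intro a b ha i₀
  have hr0 : (0 : ℤ) < r := by exact_mod_cast hr.pos
  have har := ha r (Finset.mem_insert_self _ _)
  obtain ⟨v, hv0, hv1, hv2⟩ : ∃ v, i₀ ≤ v ∧ v < i₀ + r ∧ (r : ℤ) ∣ a * v + (b - 1) :=
    exists_dvd_mul_add hr (b - 1) har i₀
  obtain ⟨e, he0, he1, he2⟩ := h (a * r) (a * v + b) (by
    intro p hp hd
    rcases (Nat.prime_iff_prime_int.1 (hS p hp)).dvd_or_dvd hd with hd | hd
    · exact ha p (Finset.mem_insert_of_mem hp) hd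
    · have : p = r := (Nat.prime_dvd_prime_iff_eq (hS p hp) hr).1 (by exact_mod_cast hd)
      exact hrS (this ▸ hp)) 0
  refine ⟨v + r * e, by nlinarith, ?_, ?_⟩
  · push_cast
    have : (e : ℤ) + 1 ≤ w := by omega
    nlinarith
  · intro p hp hd
    rcases Finset.mem_insert.1 hp with rfl | hp
    · have h1 : (p : ℤ) ∣ 1 := by
        have e1 : (1 : ℤ) = (a * (v + p * e) + b) - (a * v + (b - 1)) - p * (a * e) := by ring
        rw [e1]
        exact dvd_sub (dvd_sub hd hv2) (dvd_mul_right _ _)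
      exact hr.one_lt.ne' (by exact_mod_cast Int.eq_one_of_dvd_one hr0.le h1)
    · apply he2 p hp
      convert hd using 1; ring

/-- Legendre's sieve: the number of admissible arguments differs from its expected value by less
than `2 ^ |S|`. -/
theorem abs_card_sub_le (S : Finset ℕ) (hS : ∀ p ∈ S, p.Prime) :
    ∀ (a b : ℤ), (∀ p ∈ S, ¬ (p : ℤ) ∣ a) → ∀ (i₀ : ℤ) (L : ℕ),
      |(((Finset.Ico i₀ (i₀ + L)).filter fun i => ∀ p ∈ S, ¬ (p : ℤ) ∣ a * i + b).card : ℝ) -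
        L * ∏ p ∈ S, (1 - 1 / (p : ℝ))| ≤ 2 ^ S.card - 1 := by
  classical
  induction S using Finset.induction_on with
  | empty => intro a b _ i₀ L; simp
  | insert r S hrS ih =>
    intro a b ha i₀ L
    have hS' : ∀ p ∈ S, p.Prime := fun p hp => hS p (Finset.mem_insert_of_mem hp)
    have hr : r.Prime := hS r (Finset.mem_insert_self _ _)
    have ha' : ∀ p ∈ S, ¬ (p : ℤ) ∣ a := fun p hp => ha p (Finset.mem_insert_of_mem hp)
    have hr0 : (0 : ℝ) < r := by exact_mod_cast hr.pos
    obtain ⟨v, L', hL1, hL2, hiff⟩ :=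
      exists_residue_progression hr b (ha r (Finset.mem_insert_self _ _)) i₀ L
    set G := (Finset.Ico i₀ (i₀ + L)).filter fun i => ∀ p ∈ S, ¬ (p : ℤ) ∣ a * i + b with hG
    have hsplit := Finset.card_filter_add_card_filter_not (s := G) (fun i => (r : ℤ) ∣ a * i + b)
    have e1 : (G.filter fun i => ¬ (r : ℤ) ∣ a * i + b) =
        (Finset.Ico i₀ (i₀ + L)).filter fun i => ∀ p ∈ insert r S, ¬ (p : ℤ) ∣ a * i + b := by
      ext i
      simp only [hG, Finset.mem_filter, Finset.forall_mem_insert]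
      tauto
    -- The arguments whose value r divides form a progression v + re, on which the function is again
    -- linear, with slope ar. The induction hypothesis therefore applies to them.
    have e2 : (G.filter fun i => (r : ℤ) ∣ a * i + b) =
        ((Finset.Ico (0 : ℤ) (0 + L')).filter fun e =>
          ∀ p ∈ S, ¬ (p : ℤ) ∣ (a * r) * e + (a * v + b)).image fun e => v + r * e := by
      ext i
      simp only [hG, Finset.mem_filter, Finset.mem_image, Finset.mem_Ico, zero_add]
      constructor
      · rintro ⟨⟨⟨h1, h2⟩, h3⟩, h4⟩
        obtain ⟨e, he0, he1, rfl⟩ := (hiff i).1 ⟨h1, h2, h4⟩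
        refine ⟨e, ⟨⟨he0, he1⟩, fun p hp hd => h3 p hp ?_⟩, rfl⟩
        convert hd using 1; ring
      · rintro ⟨e, ⟨⟨he0, he1⟩, h3⟩, rfl⟩
        obtain ⟨h1, h2, h4⟩ := (hiff (v + r * e)).2 ⟨e, he0, he1, rfl⟩
        refine ⟨⟨⟨h1, h2⟩, fun p hp hd => h3 p hp ?_⟩, h4⟩
        convert hd using 1; ring
    have hinj : Function.Injective fun e : ℤ => v + r * e := by
      intro x y hxy
      simpa [hr.ne_zero] using hxy
    rw [e2, Finset.card_image_of_injective _ hinj, e1] at hsplit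
    have i1 := ih hS' a b ha' i₀ L
    have i2 := ih hS' (a * r) (a * v + b) (by
      intro p hp hd
      rcases (Nat.prime_iff_prime_int.1 (hS' p hp)).dvd_or_dvd hd with hd | hd
      · exact ha' p hp hd
      · have : p = r := (Nat.prime_dvd_prime_iff_eq (hS' p hp) hr).1 (by exact_mod_cast hd)
        exact hrS (this ▸ hp)) 0 L'
    rw [← hG] at i1
    rw [Finset.prod_insert hrS, Finset.card_insert_of_notMem hrS]
    set P := ∏ p ∈ S, (1 - 1 / (p : ℝ)) with hP
    have hfac : ∀ p ∈ S, (0 : ℝ) ≤ 1 - 1 / (p : ℝ) ∧ 1 - 1 / (p : ℝ) ≤ 1 := by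
      intro p hp
      have h1 : (1 : ℝ) ≤ p := by exact_mod_cast (hS' p hp).one_lt.le
      have h2 : 1 / (p : ℝ) ≤ 1 := by rw [div_le_one (by linarith)]; exact h1
      have h3 : 0 ≤ 1 / (p : ℝ) := by positivity
      constructor <;> linarith
    have hP0 : 0 ≤ P := Finset.prod_nonneg fun p hp => (hfac p hp).1
    have hP1 : P ≤ 1 := Finset.prod_le_one (fun p hp => (hfac p hp).1) fun p hp => (hfac p hp).2
    have hLr : |(L' : ℝ) - L / r| ≤ 1 := by
      have g1 : (L : ℝ) < r * L' + r := by exact_mod_cast hL1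
      have g2 : (r * L' : ℝ) < L + r := by exact_mod_cast hL2
      have g3 : (L' : ℝ) - L / r = (r * L' - L) / r := by field_simp
      rw [g3, abs_le]
      constructor
      · rw [le_div_iff₀ hr0]; linarith
      · rw [div_le_iff₀ hr0]; linarith
    have hprod : |((L' : ℝ) - L / r) * P| ≤ 1 := by
      rw [abs_mul, abs_of_nonneg hP0]
      exact mul_le_one₀ hLr hP0 hP1
    have hs : (((Finset.Ico (0 : ℤ) (0 + L')).filter fun e =>
        ∀ p ∈ S, ¬ (p : ℤ) ∣ (a * r) * e + (a * v + b)).card : ℝ) +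
        (((Finset.Ico i₀ (i₀ + L)).filter fun i =>
          ∀ p ∈ insert r S, ¬ (p : ℤ) ∣ a * i + b).card : ℝ) = G.card := by
      exact_mod_cast hsplit
    rw [abs_le] at i1 i2 hprod ⊢
    have hexp : (L : ℝ) * ((1 - 1 / r) * P) = L * P - L / r * P := by ring
    rw [hexp, pow_succ]
    -- Two errors of 2^k − 1, from the window and from the progression, and at most 1 from rounding
    -- L/r add up to 2^(k+1) − 1.
    constructor <;> nlinarith [i1.1, i1.2, i2.1, i2.2, hprod.1, hprod.2]

/-- The main term L ∏ (1 − 1/p) is at least 2^|S|, which exceeds the Legendre error. -/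
theorem sieved_of_prod_le {S : Finset ℕ} (hS : ∀ p ∈ S, p.Prime) {L : ℕ}
    (h : ∏ p ∈ S, (2 * p / (p - 1) : ℝ) ≤ L) : Sieved S L := by
  intro a b ha i₀
  have hab := abs_card_sub_le S hS a b ha i₀ L
  have hpos : 0 < ((Finset.Ico i₀ (i₀ + L)).filter fun i =>
      ∀ p ∈ S, ¬ (p : ℤ) ∣ a * i + b).card := by
    have hfac : ∀ p ∈ S, (0 : ℝ) < 1 - 1 / (p : ℝ) := by
      intro p hp
      have h1 : (1 : ℝ) < p := by exact_mod_cast (hS p hp).one_lt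
      have h2 : 1 / (p : ℝ) < 1 := by rw [div_lt_one (by linarith)]; exact h1
      linarith
    have hP : 0 < ∏ p ∈ S, (1 - 1 / (p : ℝ)) := Finset.prod_pos hfac
    have h1 : (∏ p ∈ S, (2 * p / (p - 1) : ℝ)) * ∏ p ∈ S, (1 - 1 / (p : ℝ)) = 2 ^ S.card := by
      rw [← Finset.prod_mul_distrib, ← Finset.prod_const]
      refine Finset.prod_congr rfl fun p hp => ?_
      have h1 : (1 : ℝ) < p := by exact_mod_cast (hS p hp).one_lt
      have h2 : (p : ℝ) - 1 ≠ 0 := by linarith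
      field_simp
    have h2 := mul_le_mul_of_nonneg_right h hP.le
    rw [h1] at h2
    rw [abs_le] at hab
    have : (0 : ℝ) < ((Finset.Ico i₀ (i₀ + L)).filter fun i =>
      ∀ p ∈ S, ¬ (p : ℤ) ∣ a * i + b).card := by linarith [hab.1]
    exact_mod_cast this
  obtain ⟨i, hi⟩ := Finset.card_pos.1 hpos
  simp only [Finset.mem_filter, Finset.mem_Ico] at hi
  exact ⟨i, hi.1.1, hi.1.2, hi.2⟩

/-! ### Small primes and products of the first primes. -/

theorem nth_prime_eq_of_count {i p : ℕ} (hp : p.Prime) (h : Nat.count Nat.Prime p = i) :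
    Nat.nth Nat.Prime i = p := by
  rw [← h, Nat.nth_count hp]

theorem nth_prime_five : Nat.nth Nat.Prime 5 = 13 :=
  nth_prime_eq_of_count (by norm_num) (by decide +kernel)

theorem nth_prime_six : Nat.nth Nat.Prime 6 = 17 :=
  nth_prime_eq_of_count (by norm_num) (by decide +kernel)

theorem nth_prime_seven : Nat.nth Nat.Prime 7 = 19 :=
  nth_prime_eq_of_count (by norm_num) (by decide +kernel)

theorem nth_prime_eight : Nat.nth Nat.Prime 8 = 23 :=
  nth_prime_eq_of_count (by norm_num) (by decide +kernel)

theorem nth_prime_nine : Nat.nth Nat.Prime 9 = 29 :=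
  nth_prime_eq_of_count (by norm_num) (by decide +kernel)

theorem nth_prime_le_two_pow (r : ℕ) : Nat.nth Nat.Prime r ≤ 2 ^ (r + 1) := by
  induction r with
  | zero => simp
  | succ r ih =>
    have hp := Nat.prime_nth_prime r
    obtain ⟨p, hp1, hp2, hp3⟩ := Nat.exists_prime_lt_and_le_two_mul _ hp.ne_zero
    have h : Nat.nth Nat.Prime (r + 1) ≤ p := by
      have h1 : r + 1 ≤ Nat.count Nat.Prime p := by
        by_contra! h2
        exact hp2.not_ge ((Nat.count_le_iff_le_nth Nat.infinite_setOfPred_prime).1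
          (Nat.lt_succ_iff.1 h2))
      calc Nat.nth Nat.Prime (r + 1) ≤ Nat.nth Nat.Prime (Nat.count Nat.Prime p) :=
            Nat.nth_monotone Nat.infinite_setOfPred_prime h1
        _ = p := Nat.nth_count hp1
    calc _ ≤ p := h
      _ ≤ 2 * _ := hp3
      _ ≤ 2 * 2 ^ (r + 1) := by gcongr
      _ = _ := by ring

theorem one_le_prod_real {ι : Type*} {s : Finset ι} {f : ι → ℝ} (h : ∀ i ∈ s, 1 ≤ f i) :
    1 ≤ ∏ i ∈ s, f i := by
  calc (1 : ℝ) = ∏ _i ∈ s, (1 : ℝ) := by simp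
    _ ≤ _ := Finset.prod_le_prod (fun _ _ => zero_le_one) h

/-- Among all sets of `k` primes, the first `k` primes minimise the product of a monotone
function. -/
theorem prod_nth_prime_le_prod {f : ℕ → ℝ} (hf0 : ∀ x, 2 ≤ x → 0 ≤ f x)
    (hf : ∀ x y, 2 ≤ x → x ≤ y → f x ≤ f y) (k : ℕ) :
    ∀ S : Finset ℕ, (∀ p ∈ S, p.Prime) → S.card = k →
      ∏ i ∈ Finset.range k, f (Nat.nth Nat.Prime i) ≤ ∏ p ∈ S, f p := by
  induction k with
  | zero =>
    intro S _ hS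
    rw [Finset.card_eq_zero.1 hS]
    simp
  | succ k ih =>
    intro S hS hc
    have hne : S.Nonempty := Finset.card_pos.1 (by omega)
    set x := S.max' hne with hx
    have hxS : x ∈ S := S.max'_mem hne
    rw [Finset.prod_range_succ, ← Finset.prod_erase_mul S f hxS]
    have h1 : Nat.nth Nat.Prime k ≤ x := by
      have h2 : k < Nat.count Nat.Prime (x + 1) := by
        rw [Nat.count_eq_card_filter_range]
        calc k < S.card := by omega
          _ ≤ _ := Finset.card_le_card fun p hp => Finset.mem_filter.2
            ⟨Finset.mem_range.2 (Nat.lt_succ_of_le (S.le_max' p hp)), hS p hp⟩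
      exact Nat.lt_succ_iff.1 (Nat.nth_lt_of_lt_count h2)
    have h4 : 2 ≤ Nat.nth Nat.Prime k := (Nat.prime_nth_prime k).two_le
    refine mul_le_mul (ih _ (fun p hp => hS p (Finset.mem_of_mem_erase hp)) ?_) (hf _ _ h4 h1)
      (hf0 _ h4) (Finset.prod_nonneg fun p hp => hf0 _ (hS p (Finset.mem_of_mem_erase hp)).two_le)
    rw [Finset.card_erase_of_mem hxS, hc]
    rfl

theorem prod_nth_prime_le {k : ℕ} {S : Finset ℕ} (hS : ∀ p ∈ S, p.Prime) (hc : k ≤ S.card) :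
    ∏ i ∈ Finset.range k, Nat.nth Nat.Prime i ≤ ∏ p ∈ S, p := by
  obtain ⟨T, hT, hTc⟩ := Finset.exists_subset_card_eq hc
  have h := prod_nth_prime_le_prod (f := fun x => (x : ℝ)) (fun x _ => by positivity)
    (fun x y _ h => by exact_mod_cast h) k T (fun p hp => hS p (hT hp)) hTc
  have h2 : ∏ i ∈ Finset.range k, Nat.nth Nat.Prime i ≤ ∏ p ∈ T, p := by
    have h' : ((∏ i ∈ Finset.range k, Nat.nth Nat.Prime i : ℕ) : ℝ) ≤ (∏ p ∈ T, p : ℕ) := by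
      rw [Nat.cast_prod, Nat.cast_prod]
      exact h
    exact Nat.cast_le.1 h'
  exact h2.trans (Finset.prod_le_prod_of_subset_of_one_le' hT fun p hp _ => (hS p hp).one_lt.le)

theorem prod_nth_prime_le_self {k n : ℕ} (hn : n ≠ 0) (hc : k ≤ n.primeFactors.card) :
    ∏ i ∈ Finset.range k, Nat.nth Nat.Prime i ≤ n :=
  (prod_nth_prime_le (fun _ hp => Nat.prime_of_mem_primeFactors hp) hc).trans
    (Nat.le_of_dvd (Nat.pos_of_ne_zero hn) (Nat.prod_primeFactors_dvd n))

/-! ### Explicit window lengths for few primes. -/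

theorem Sieved.of_erase {S : Finset ℕ} (hS : ∀ p ∈ S, p.Prime) {r w : ℕ} (hr : r.Prime)
    (h : Sieved (S.erase r) w) : Sieved S (if r ∈ S then r * w else w) := by
  split_ifs with hrS
  · have := h.insert (fun p hp => hS p (Finset.mem_of_mem_erase hp)) hr (Finset.notMem_erase r S)
    rwa [Finset.insert_erase hrS] at this
  · rwa [Finset.erase_eq_of_notMem hrS] at h

/-- No prime of S removes two of |S| + 1 consecutive arguments. -/
theorem sieved_succ_card {S : Finset ℕ} (hS : ∀ p ∈ S, p.Prime) (h : ∀ p ∈ S, S.card + 1 ≤ p) :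
    Sieved S (S.card + 1) :=
  sieved_of_excess (E := ∅) hS (fun p hp _ => h p hp) (by simp)

theorem le_of_prime_of_le_of_notMem {m w p : ℕ} {E : Finset ℕ}
    (hE : ∀ x < w, m ≤ x → x.Prime → x ∈ E) (hp : p.Prime) (hm : m ≤ p) (hpE : p ∉ E) : w ≤ p := by
  by_contra! h
  exact hpE (hE p h hm hp)

/-- Window lengths that suffice for `r` odd primes. -/
theorem sieved_odd {S : Finset ℕ} (hS : ∀ p ∈ S, p.Prime) (h3 : ∀ p ∈ S, 3 ≤ p) :
    (S.card ≤ 2 → Sieved S (S.card + 1)) ∧ (S.card ≤ 3 → Sieved S 5) ∧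
      (S.card ≤ 4 → Sieved S 9) := by
  refine ⟨fun h => sieved_succ_card hS fun p hp => ?_, fun h => ?_, fun h => ?_⟩
  · have := h3 p hp
    omega
  · refine sieved_of_excess (E := {3}) hS (fun p hp =>
      le_of_prime_of_le_of_notMem (by decide) (hS p hp) (h3 p hp)) ?_
    have : ∑ p ∈ ({3} : Finset ℕ), ((5 + p - 1) / p - 1) = 1 := by decide
    omega
  -- `E` holds the odd primes below the window length. Of 9 arguments 3 removes three, and 5 and 7
  -- at most two each: an excess of 4 over one apiece.
  · refine sieved_of_excess (E := {3, 5, 7}) hS (fun p hp =>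
      le_of_prime_of_le_of_notMem (by decide) (hS p hp) (h3 p hp)) ?_
    have : ∑ p ∈ ({3, 5, 7} : Finset ℕ), ((9 + p - 1) / p - 1) = 4 := by decide
    omega

/-- Window lengths that suffice for `r` primes `≥ 5`. -/
theorem sieved_five {S : Finset ℕ} (hS : ∀ p ∈ S, p.Prime) (h5 : ∀ p ∈ S, 5 ≤ p) :
    (S.card ≤ 4 → Sieved S 5) ∧ (S.card ≤ 5 → Sieved S 7) ∧ (S.card ≤ 6 → Sieved S 9) ∧
      (S.card ≤ 7 → Sieved S 10) ∧ (S.card ≤ 8 → Sieved S 13) ∧ (S.card ≤ 9 → Sieved S 17) := by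
  refine ⟨fun h => ?_, fun h => ?_, fun h => ?_, fun h => ?_, fun h => ?_, fun h => ?_⟩
  · refine sieved_of_excess (E := ∅) hS (fun p hp _ => h5 p hp) ?_
    simp only [Finset.sum_empty]
    omega
  · refine sieved_of_excess (E := {5}) hS (fun p hp =>
      le_of_prime_of_le_of_notMem (by decide) (hS p hp) (h5 p hp)) ?_
    have : ∑ p ∈ ({5} : Finset ℕ), ((7 + p - 1) / p - 1) = 1 := by decide
    omega
  · refine sieved_of_excess (E := {5, 7}) hS (fun p hp =>
      le_of_prime_of_le_of_notMem (by decide) (hS p hp) (h5 p hp)) ?_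
    have : ∑ p ∈ ({5, 7} : Finset ℕ), ((9 + p - 1) / p - 1) = 2 := by decide
    omega
  · refine sieved_of_excess (E := {5, 7}) hS (fun p hp =>
      le_of_prime_of_le_of_notMem (by decide) (hS p hp) (h5 p hp)) ?_
    have : ∑ p ∈ ({5, 7} : Finset ℕ), ((10 + p - 1) / p - 1) = 2 := by decide
    omega
  · refine sieved_of_excess (E := {5, 7, 11}) hS (fun p hp =>
      le_of_prime_of_le_of_notMem (by decide) (hS p hp) (h5 p hp)) ?_
    have : ∑ p ∈ ({5, 7, 11} : Finset ℕ), ((13 + p - 1) / p - 1) = 4 := by decide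
    omega
  · refine sieved_of_excess (E := {5, 7, 11, 13}) hS (fun p hp =>
      le_of_prime_of_le_of_notMem (by decide) (hS p hp) (h5 p hp)) ?_
    have : ∑ p ∈ ({5, 7, 11, 13} : Finset ℕ), ((17 + p - 1) / p - 1) = 7 := by decide
    omega

theorem five_le_of_prime {p : ℕ} (hp : p.Prime) (h2 : p ≠ 2) (h3 : p ≠ 3) : 5 ≤ p := by
  by_contra! h
  interval_cases p <;> revert hp h2 h3 <;> decide

theorem sieved_of_erase_two_three {S : Finset ℕ} (hS : ∀ p ∈ S, p.Prime) {w : ℕ}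
    (h : Sieved ((S.erase 2).erase 3) w) :
    Sieved S ((if 2 ∈ S then 2 else 1) * ((if 3 ∈ S then 3 else 1) * w)) := by
  have h1 := (h.of_erase (fun p hp => hS p (Finset.mem_of_mem_erase hp)) Nat.prime_three).of_erase
    hS Nat.prime_two
  convert h1 using 1
  have : 3 ∈ S.erase 2 ↔ 3 ∈ S := by simp
  simp only [this]
  split_ifs <;> ring

theorem five_le_of_mem_erase {S : Finset ℕ} (hS : ∀ p ∈ S, p.Prime) :
    ∀ p ∈ (S.erase 2).erase 3, p.Prime ∧ 5 ≤ p := by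
  intro p hp
  simp only [Finset.mem_erase] at hp
  exact ⟨hS p hp.2.2, five_le_of_prime (hS p hp.2.2) hp.2.1 hp.1⟩

/-! ### Windows L with (2qL + 2)² ≤ n. -/

/-- A set `K` of primes dividing `n`, together with the least prime `q` outside it. -/
structure LeastPrimeNotMem (n : ℕ) (K : Finset ℕ) (q : ℕ) : Prop where
  subset : K ⊆ n.primeFactors
  prime : q.Prime
  notMem : q ∉ K
  mem_of_lt : ∀ p, p.Prime → p < q → p ∈ K

namespace LeastPrimeNotMem

variable {n : ℕ} {K : Finset ℕ} {q : ℕ}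

theorem count_le_card (h : LeastPrimeNotMem n K q) : Nat.count Nat.Prime q ≤ K.card := by
  rw [Nat.count_eq_card_filter_range]
  refine Finset.card_le_card fun p hp => ?_
  rw [Finset.mem_filter, Finset.mem_range] at hp
  exact h.mem_of_lt p hp.2 hp.1

theorem le_nth_prime (h : LeastPrimeNotMem n K q) {r : ℕ} (hr : K.card ≤ r) :
    q ≤ Nat.nth Nat.Prime r :=
  (Nat.count_le_iff_le_nth Nat.infinite_setOfPred_prime).1 (h.count_le_card.trans hr)

theorem card_add_card (h : LeastPrimeNotMem n K q) :
    (n.primeFactors \ K).card + K.card = n.primeFactors.card :=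
  Finset.card_sdiff_add_card_eq_card h.subset

theorem prime_of_mem_sdiff : ∀ p ∈ n.primeFactors \ K, p.Prime := fun _ hp =>
  Nat.prime_of_mem_primeFactors (Finset.mem_sdiff.1 hp).1

theorem le_of_mem_sdiff (h : LeastPrimeNotMem n K q) : ∀ p ∈ n.primeFactors \ K, q ≤ p := by
  intro p hp
  by_contra! hlt
  exact (Finset.mem_sdiff.1 hp).2 (h.mem_of_lt p (prime_of_mem_sdiff p hp) hlt)

theorem exists_window_of_ten_le (h : LeastPrimeNotMem n K q) (hn : n ≠ 0)
    (hk : 10 ≤ n.primeFactors.card) :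
    ∃ L, Sieved (n.primeFactors \ K) L ∧ (2 * q * L + 2) ^ 2 ≤ n := by
  set S := n.primeFactors \ K with hSdef
  have hP : ∀ p ∈ n.primeFactors, p.Prime := fun p hp => Nat.prime_of_mem_primeFactors hp
  have hP1 : ∀ p ∈ n.primeFactors, (2 : ℝ) ≤ p := fun p hp => by exact_mod_cast (hP p hp).two_le
  have hfac : ∀ p ∈ n.primeFactors, (2 : ℝ) ≤ 2 * p / (p - 1) := by
    intro p hp
    have := hP1 p hp
    rw [le_div_iff₀ (by linarith)]
    linarith
  have hSK : S ⊆ n.primeFactors := Finset.sdiff_subset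
  set X := ∏ p ∈ n.primeFactors, (2 * p / (p - 1) : ℝ) with hX
  set Y := ∏ p ∈ S, (2 * p / (p - 1) : ℝ) with hY
  have hY1 : 1 ≤ Y := one_le_prod_real fun p hp => by linarith [hfac p (hSK hp)]
  have hXY : (2 : ℝ) ^ K.card * Y ≤ X := by
    rw [hX, ← Finset.prod_sdiff h.subset, mul_comm]
    gcongr
    rw [← Finset.prod_const]
    exact Finset.prod_le_prod (fun _ _ => by norm_num) fun p hp => hfac p (h.subset hp)
  have hX2 : 2 ≤ X := by
    have h1 : (2 : ℝ) ^ n.primeFactors.card ≤ X := by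
      rw [← Finset.prod_const]
      exact Finset.prod_le_prod (fun _ _ => by norm_num) hfac
    have h2 : (2 : ℝ) ^ 1 ≤ 2 ^ n.primeFactors.card :=
      pow_le_pow_right₀ (by norm_num) (by omega)
    linarith
  -- Members of K contribute at least 2^|K| to X, while q ≤ 2^(|K|+1) by Bertrand. Hence qL ≤ 4X,
  -- and 2qL + 2 ≤ 9X.
  refine ⟨⌈Y⌉₊, sieved_of_prod_le prime_of_mem_sdiff (Nat.le_ceil Y), ?_⟩
  have hL : (⌈Y⌉₊ : ℝ) ≤ 2 * Y := by linarith [Nat.ceil_lt_add_one (by linarith : 0 ≤ Y)]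
  have hq : (q : ℝ) ≤ 2 ^ (K.card + 1) := by
    exact_mod_cast (h.le_nth_prime le_rfl).trans (nth_prime_le_two_pow _)
  have hqL : (2 * q * ⌈Y⌉₊ + 2 : ℝ) ≤ 9 * X := by
    have : (q : ℝ) * ⌈Y⌉₊ ≤ 2 ^ (K.card + 1) * (2 * Y) := by gcongr
    rw [pow_succ] at this
    nlinarith
  have hmain : 81 * X ^ 2 ≤ ∏ p ∈ n.primeFactors, (p : ℝ) := by
    -- f(p) is p divided by the square of the factor 2p/(p − 1) of X. Its product over the first ten
    -- primes exceeds 81, over the first nine it does not, and every later factor is at least 1.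
    set f : ℕ → ℝ := fun p => (p - 1) ^ 2 / (4 * p) with hf
    have hf0 : ∀ x : ℕ, 2 ≤ x → 0 ≤ f x := fun x _ => by positivity
    have hfm : ∀ x y : ℕ, 2 ≤ x → x ≤ y → f x ≤ f y := by
      intro x y hx hxy
      have hx' : (2 : ℝ) ≤ x := by exact_mod_cast hx
      have hxy' : (x : ℝ) ≤ y := by exact_mod_cast hxy
      simp only [hf]
      rw [div_le_div_iff₀ (by linarith) (by linarith)]
      nlinarith [mul_nonneg (sub_nonneg.2 hxy') (by nlinarith : (0 : ℝ) ≤ x * y - 1)]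
    have h1 := prod_nth_prime_le_prod hf0 hfm _ _ hP rfl
    have h2 : (81 : ℝ) ≤ ∏ i ∈ Finset.range n.primeFactors.card, f (Nat.nth Nat.Prime i) := by
      rw [← Finset.prod_range_mul_prod_Ico _ hk]
      have h3 : (81 : ℝ) ≤ ∏ i ∈ Finset.range 10, f (Nat.nth Nat.Prime i) := by
        simp only [Finset.prod_range_succ, Finset.prod_range_zero, Nat.nth_prime_zero_eq_two,
          Nat.nth_prime_one_eq_three, Nat.nth_prime_two_eq_five, Nat.nth_prime_three_eq_seven,
          Nat.nth_prime_four_eq_eleven, nth_prime_five, nth_prime_six, nth_prime_seven,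
          nth_prime_eight, nth_prime_nine, hf]
        norm_num
      have h4 : (1 : ℝ) ≤ ∏ i ∈ Finset.Ico 10 n.primeFactors.card, f (Nat.nth Nat.Prime i) := by
        refine one_le_prod_real fun i hi => ?_
        have h5 : 29 ≤ Nat.nth Nat.Prime i := by
          rw [← nth_prime_nine]
          exact Nat.nth_monotone Nat.infinite_setOfPred_prime
            (by have := (Finset.mem_Ico.1 hi).1; omega)
        refine le_trans ?_ (hfm 29 _ (by norm_num) h5)
        simp only [hf]
        norm_num
      nlinarith
    have h5 : (∏ p ∈ n.primeFactors, f p) * X ^ 2 = ∏ p ∈ n.primeFactors, (p : ℝ) := by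
      rw [hX, ← Finset.prod_pow, ← Finset.prod_mul_distrib]
      refine Finset.prod_congr rfl fun p hp => ?_
      have := hP1 p hp
      have h6 : (p : ℝ) - 1 ≠ 0 := by linarith
      have h7 : (p : ℝ) ≠ 0 := by linarith
      simp only [hf]
      field_simp
      norm_num
    rw [← h5]
    have := h2.trans h1
    gcongr
  have hle : (∏ p ∈ n.primeFactors, (p : ℝ)) ≤ n := by
    rw [← Nat.cast_prod]
    exact Nat.cast_le.2 (Nat.le_of_dvd (Nat.pos_of_ne_zero hn) (Nat.prod_primeFactors_dvd n))
  have hfin : (2 * q * ⌈Y⌉₊ + 2 : ℝ) ^ 2 ≤ n := by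
    calc (2 * q * ⌈Y⌉₊ + 2 : ℝ) ^ 2 ≤ (9 * X) ^ 2 := by gcongr
      _ = 81 * X ^ 2 := by ring
      _ ≤ n := hmain.trans hle
  exact_mod_cast hfin

/-- A larger q costs more, but then 2, or both 2 and 3, lie in K and need no sieving. -/
theorem cases_q (h : LeastPrimeNotMem n K q) :
    q = 2 ∨ (q = 3 ∧ 2 ∉ n.primeFactors \ K ∧ 1 ≤ K.card) ∨
      (5 ≤ q ∧ 2 ≤ K.card ∧ ∀ p ∈ n.primeFactors \ K, 5 ≤ p) := by
  have hc := h.count_le_card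
  by_cases h2 : q = 2
  · exact Or.inl h2
  by_cases h3 : q = 3
  · subst h3
    refine Or.inr (Or.inl ⟨rfl, fun hm => ?_, ?_⟩)
    · have := h.le_of_mem_sdiff 2 hm
      omega
    · have : Nat.count Nat.Prime 3 = 1 := by decide
      omega
  · have h5 := five_le_of_prime h.prime h2 h3
    refine Or.inr (Or.inr ⟨h5, ?_, fun p hp => h5.trans (h.le_of_mem_sdiff p hp)⟩)
    have h6 := Nat.count_monotone Nat.Prime h5
    have : Nat.count Nat.Prime 5 = 2 := by decide
    omega

theorem exists_window_of_six_le (h : LeastPrimeNotMem n K q) (hn : n ≠ 0)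
    (hk6 : 6 ≤ n.primeFactors.card) (hk9 : n.primeFactors.card ≤ 9) :
    ∃ L, Sieved (n.primeFactors \ K) L ∧ (2 * q * L + 2) ^ 2 ≤ n := by
  have hS := prime_of_mem_sdiff (n := n) (K := K)
  have hcard := h.card_add_card
  have hq := h.le_nth_prime (r := n.primeFactors.card) (by omega)
  have hprod := prod_nth_prime_le_self hn le_rfl
  have hcq := h.cases_q
  set k := n.primeFactors.card with hk
  set S := n.primeFactors \ K with hSdef
  have hS' := five_le_of_mem_erase hS
  have hw := sieved_five (fun p hp => (hS' p hp).1) (fun p hp => (hS' p hp).2)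
  have he : ((S.erase 2).erase 3).card + (if 2 ∈ S then 1 else 0) + (if 3 ∈ S then 1 else 0) =
      S.card := by
    have h32 : 3 ∈ S.erase 2 ↔ 3 ∈ S := by simp
    have h2 : (S.erase 2).card + (if 2 ∈ S then 1 else 0) = S.card := by
      split_ifs with h
      · exact Finset.card_erase_add_one h
      · rw [Finset.erase_eq_of_notMem h, add_zero]
    have h3 : ((S.erase 2).erase 3).card + (if 3 ∈ S then 1 else 0) = (S.erase 2).card := by
      split_ifs with h
      · exact Finset.card_erase_add_one (h32.2 h)
      · rw [Finset.erase_eq_of_notMem (h32.not.2 h), add_zero]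
    omega
  have hstride : ∀ w, Sieved ((S.erase 2).erase 3) w → Sieved S (6 * w) := by
    intro w hw
    refine (sieved_of_erase_two_three hS hw).mono ?_
    split_ifs <;> omega
  have hbig : ∀ {L Q : ℕ}, Sieved S L → q ≤ Q → (2 * Q * L + 2) ^ 2 ≤ n →
      ∃ L, Sieved S L ∧ (2 * q * L + 2) ^ 2 ≤ n := fun hL hQ hle =>
    ⟨_, hL, le_trans (by gcongr) hle⟩
  have hk4 : k = 6 ∨ k = 7 ∨ k = 8 ∨ k = 9 := by omega
  rcases hcq with hq2 | ⟨hq3, h2S, hK1⟩ | ⟨hq5, hK2, hS5⟩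
  · rcases hk4 with h6 | h6 | h6 | h6 <;> rw [h6] at hprod <;>
      simp only [Finset.prod_range_succ, Finset.prod_range_zero, Nat.nth_prime_zero_eq_two,
          Nat.nth_prime_one_eq_three, Nat.nth_prime_two_eq_five, Nat.nth_prime_three_eq_seven,
          Nat.nth_prime_four_eq_eleven, nth_prime_five, nth_prime_six, nth_prime_seven,
          nth_prime_eight] at hprod
    -- The generic length 6w is too long for n near 30030. Instead, each of 2 and 3 present in S
    -- leaves one prime fewer among those ≥ 5.
    · have hL : Sieved S 30 := by
        by_cases h2 : 2 ∈ S <;> by_cases h3 : 3 ∈ S <;> simp only [h2, h3, if_true, if_false] at he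
        · simpa [h2, h3] using sieved_of_erase_two_three hS (hw.1 (by omega))
        · refine (sieved_of_erase_two_three hS (hw.2.1 (by omega))).mono (by simp [h2, h3])
        · refine (sieved_of_erase_two_three hS (hw.2.1 (by omega))).mono (by simp [h2, h3])
        · refine (sieved_of_erase_two_three hS (hw.2.2.1 (by omega))).mono (by simp [h2, h3])
      exact hbig hL hq2.le (by omega)
    · exact hbig (hstride _ (hw.2.2.2.1 (by omega))) hq2.le (by omega)
    · exact hbig (hstride _ (hw.2.2.2.2.1 (by omega))) hq2.le (by omega)
    · exact hbig (hstride _ (hw.2.2.2.2.2 (by omega))) hq2.le (by omega)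
  · rcases hk4 with h6 | h6 | h6 | h6 <;> rw [h6] at hprod <;>
      simp only [Finset.prod_range_succ, Finset.prod_range_zero, Nat.nth_prime_zero_eq_two,
          Nat.nth_prime_one_eq_three, Nat.nth_prime_two_eq_five, Nat.nth_prime_three_eq_seven,
          Nat.nth_prime_four_eq_eleven, nth_prime_five, nth_prime_six, nth_prime_seven,
          nth_prime_eight] at hprod
    · have hL : Sieved S 21 := by
        by_cases h3 : 3 ∈ S <;> simp only [h2S, h3, if_true, if_false] at he
        · exact (sieved_of_erase_two_three hS (hw.2.1 (by omega))).mono (by simp [h2S, h3])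
        · exact (sieved_of_erase_two_three hS (hw.2.1 (by omega))).mono (by simp [h2S, h3])
      exact hbig hL hq3.le (by omega)
    · exact hbig (hstride _ (hw.2.2.2.1 (by omega))) hq3.le (by omega)
    · exact hbig (hstride _ (hw.2.2.2.2.1 (by omega))) hq3.le (by omega)
    · exact hbig (hstride _ (hw.2.2.2.2.2 (by omega))) hq3.le (by omega)
  · have hw5 := sieved_five hS hS5
    rcases hk4 with h6 | h6 | h6 | h6 <;> rw [h6] at hprod hq <;>
      simp only [Finset.prod_range_succ, Finset.prod_range_zero, Nat.nth_prime_zero_eq_two,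
          Nat.nth_prime_one_eq_three, Nat.nth_prime_two_eq_five, Nat.nth_prime_three_eq_seven,
          Nat.nth_prime_four_eq_eleven, nth_prime_five, nth_prime_six, nth_prime_seven,
          nth_prime_eight, nth_prime_nine] at hprod hq
    -- The tight case: (2·17·5 + 2)² = 29584 against 30030.
    · exact hbig (hw5.1 (by omega)) hq (by omega)
    · exact hbig (hw5.2.1 (by omega)) hq (by omega)
    · exact hbig (hw5.2.2.1 (by omega)) hq (by omega)
    · exact hbig (hw5.2.2.2.1 (by omega)) hq (by omega)

end LeastPrimeNotMem

/-- The size of `n` beyond which the sieve succeeds, in terms of the number of its primes. -/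
structure SieveRange (n : ℕ) : Prop where
  base : 100 ≤ n
  two : 2 ≤ n.primeFactors.card → 324 ≤ n
  three : 3 ≤ n.primeFactors.card → 676 ≤ n
  four : 4 ≤ n.primeFactors.card → 1764 ≤ n
  five : 5 ≤ n.primeFactors.card → 5476 ≤ n

namespace LeastPrimeNotMem

variable {n : ℕ} {K : Finset ℕ} {q : ℕ}

theorem exists_window_of_le_five (h : LeastPrimeNotMem n K q) (hn : SieveRange n)
    (hk5 : n.primeFactors.card ≤ 5) :
    ∃ L, Sieved (n.primeFactors \ K) L ∧ (2 * q * L + 2) ^ 2 ≤ n := by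
  obtain ⟨hb1, hb2, hb3, hb4, hb5⟩ := hn
  have hS := prime_of_mem_sdiff (n := n) (K := K)
  have hcard := h.card_add_card
  have hq := h.le_nth_prime (r := 5) (by omega)
  have hcount := h.count_le_card
  have hcq := h.cases_q
  have hk1 : 1 ≤ n.primeFactors.card :=
    Finset.card_pos.2 (Nat.nonempty_primeFactors.2 (by omega))
  set k := n.primeFactors.card with hk
  set S := n.primeFactors \ K with hSdef
  have hodd : ∀ {T : Finset ℕ}, T ⊆ S → 2 ∉ T → ∀ p ∈ T, 3 ≤ p := by
    intro T hT h2 p hp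
    have h1 := (hS p (hT hp)).two_le
    have h3 : p ≠ 2 := fun h => h2 (h ▸ hp)
    omega
  have hkc : k = 1 ∨ k = 2 ∨ k = 3 ∨ k = 4 ∨ k = 5 := by omega
  -- The lengths w = 1, 2, 3, 5, 9 give (8w + 2)² = 100, 324, 676, 1764, 5476, the thresholds of
  -- `SieveRange`. Here 8w is 2qL for q = 2 and L = 2w, the cost when 2 itself is sieved.
  have hw : ∀ {T : Finset ℕ}, T ⊆ S → 2 ∉ T → T.card + 1 ≤ k →
      ∃ w, Sieved T w ∧ (8 * w + 2) ^ 2 ≤ n := by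
    intro T hT h2 hc
    have hT' := sieved_odd (fun p hp => hS p (hT hp)) (hodd hT h2)
    rcases hkc with h1 | h1 | h1 | h1 | h1
    · exact ⟨1, (hT'.1 (by omega)).mono (by omega), by omega⟩
    · exact ⟨2, (hT'.1 (by omega)).mono (by omega), by omega⟩
    · exact ⟨3, (hT'.1 (by omega)).mono (by omega), by omega⟩
    · exact ⟨5, hT'.2.1 (by omega), by omega⟩
    · exact ⟨9, hT'.2.2 (by omega), by omega⟩
  rcases hcq with rfl | ⟨rfl, h2S, hK1⟩ | ⟨hq5, hK2, hS5⟩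
  · by_cases h2 : 2 ∈ S
    · obtain ⟨w, hw1, hw2⟩ := hw (T := S.erase 2) (Finset.erase_subset _ _) (by simp)
        (by rw [Finset.card_erase_of_mem h2]; have := Finset.card_pos.2 ⟨2, h2⟩; omega)
      have := hw1.of_erase hS Nat.prime_two
      rw [if_pos h2] at this
      exact ⟨2 * w, this, le_trans (le_of_eq (by ring)) hw2⟩
    · have hS' := sieved_odd hS (hodd subset_rfl h2)
      rcases hkc with h1 | h1 | h1 | h1 | h1
      · exact ⟨2, (hS'.1 (by omega)).mono (by omega), by omega⟩
      · exact ⟨3, (hS'.1 (by omega)).mono (by omega), by omega⟩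
      · exact ⟨5, hS'.2.1 (by omega), by omega⟩
      · exact ⟨9, hS'.2.2 (by omega), by omega⟩
      · refine ⟨18, ?_, by omega⟩
        have h5 := sieved_five (S := (S.erase 2).erase 3)
          (fun p hp => (five_le_of_mem_erase hS p hp).1)
          (fun p hp => (five_le_of_mem_erase hS p hp).2)
        rw [Finset.erase_eq_of_notMem h2] at h5
        by_cases h3 : 3 ∈ S
        · have hc : (S.erase 3).card ≤ 4 := by rw [Finset.card_erase_of_mem h3]; omega
          have := (h5.1 hc).of_erase hS Nat.prime_three
          rw [if_pos h3] at this
          exact this.mono (by norm_num)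
        · rw [Finset.erase_eq_of_notMem h3] at h5
          exact (h5.2.1 (by omega)).mono (by norm_num)
  · obtain ⟨w, hw1, hw2⟩ := hw (T := S) subset_rfl h2S (by omega)
    exact ⟨w, hw1, le_trans (Nat.pow_le_pow_left (by omega) 2) hw2⟩
  · refine ⟨_, sieved_succ_card hS fun p hp => ?_, ?_⟩
    · have := hS5 p hp
      omega
    · rw [nth_prime_five] at hq
      have hqc : q = 5 ∨ q = 7 ∨ q = 11 ∨ q = 13 := by
        have := h.prime
        interval_cases q <;> first | omega | (revert this; norm_num)
      have hc5 : Nat.count Nat.Prime 5 = 2 := by decide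
      have hc7 : Nat.count Nat.Prime 7 = 3 := by decide
      have hc11 : Nat.count Nat.Prime 11 = 4 := by decide
      have hc13 : Nat.count Nat.Prime 13 = 5 := by decide
      have hpow : ∀ {B : ℕ}, 2 * q * (S.card + 1) + 2 ≤ B → B ^ 2 ≤ n →
          (2 * q * (S.card + 1) + 2) ^ 2 ≤ n := fun h1 h2 =>
        (Nat.pow_le_pow_left h1 2).trans h2
      rcases hqc with rfl | rfl | rfl | rfl
      · have hc : S.card + 3 ≤ k + 1 := by omega
        rcases hkc with h1 | h1 | h1 | h1 | h1
        · omega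
        · exact hpow (B := 18) (by omega) (by omega)
        · exact hpow (B := 26) (by omega) (by omega)
        · exact hpow (B := 42) (by omega) (by omega)
        · exact hpow (B := 74) (by omega) (by omega)
      all_goals
        rcases hkc with h1 | h1 | h1 | h1 | h1
        · omega
        · omega
        · first | omega | exact hpow (B := 26) (by omega) (by omega)
        · first | omega | exact hpow (B := 42) (by omega) (by omega)
        · exact hpow (B := 74) (by omega) (by omega)

theorem exists_window (h : LeastPrimeNotMem n K q) (hn : SieveRange n) :
    ∃ L, Sieved (n.primeFactors \ K) L ∧ (2 * q * L + 2) ^ 2 ≤ n := by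
  have hn0 : n ≠ 0 := by have := hn.base; omega
  by_cases h5 : n.primeFactors.card ≤ 5
  · exact h.exists_window_of_le_five hn h5
  by_cases h9 : n.primeFactors.card ≤ 9
  · exact h.exists_window_of_six_le hn0 (by omega) h9
  · exact h.exists_window_of_ten_le hn0 (by omega)

end LeastPrimeNotMem

theorem exists_leastPrimeNotMem {n : ℕ} {K : Finset ℕ} (hK : K ⊆ n.primeFactors) :
    ∃ q, LeastPrimeNotMem n K q := by
  classical
  have hex : ∃ q, q.Prime ∧ q ∉ K := by
    obtain ⟨q, hq, hqK⟩ := Nat.infinite_setOfPred_prime.exists_notMem_finset K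
    exact ⟨q, hq, hqK⟩
  refine ⟨Nat.find hex, hK, (Nat.find_spec hex).1, (Nat.find_spec hex).2, fun p hp hlt => ?_⟩
  by_contra h
  exact Nat.find_min hex hlt ⟨hp, h⟩

/-! ### The lattice y ≡ tx mod n: short vector and rows. -/

/-- Thue's lemma, with the witness made primitive in the lattice `{(x, y) | y ≡ t x mod n}`. -/
theorem exists_short_vector {n : ℕ} (hn : 2 ≤ n) (t : ℤ) :
    ∃ a c m : ℤ, 0 < a ∧ a ^ 2 ≤ n ∧ c ^ 2 ≤ n ∧ a * t - c = n * m ∧ IsCoprime a m := by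
  have hn0 : NeZero n := ⟨by omega⟩
  set r := Nat.sqrt n with hr
  have hr2 : r * r ≤ n := Nat.sqrt_le n
  have hr3 : n < (r + 1) * (r + 1) := Nat.lt_succ_sqrt n
  have hrn : r < n := Nat.sqrt_lt_self hn
  obtain ⟨⟨x, y⟩, ⟨x', y'⟩, hne, heq⟩ := Fintype.exists_ne_map_eq_of_card_lt
    (fun z : Fin (r + 1) × Fin (r + 1) => (t * (z.1 : ℕ) - (z.2 : ℕ) : ZMod n))
    (by simpa [ZMod.card] using hr3)
  have hdvd : (n : ℤ) ∣ ((x : ℕ) - (x' : ℕ) : ℤ) * t - ((y : ℕ) - (y' : ℕ) : ℤ) := by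
    rw [← ZMod.intCast_zmod_eq_zero_iff_dvd]
    push_cast
    simp only at heq
    linear_combination heq
  have hx := x.2
  have hx' := x'.2
  have hy := y.2
  have hy' := y'.2
  have hsq : ∀ d : ℤ, -r ≤ d → d ≤ r → d ^ 2 ≤ n := by
    intro d h1 h2
    have h3 : (r * r : ℤ) ≤ n := by exact_mod_cast hr2
    nlinarith
  -- With equal first coordinates, n would divide a difference of second coordinates of size below
  -- n.
  have ha : ((x : ℕ) - (x' : ℕ) : ℤ) ≠ 0 := by
    intro h0
    rw [h0, zero_mul, zero_sub, dvd_neg] at hdvd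
    have h1 : ((y : ℕ) - (y' : ℕ) : ℤ) = 0 := by
      refine Int.eq_zero_of_abs_lt_dvd hdvd ?_
      rw [abs_lt]
      constructor <;> omega
    exact hne (Prod.ext (Fin.ext (by simp only; omega)) (Fin.ext (by simp only; omega)))
  obtain ⟨a, c, ha0, ha2, hc2, m, hm⟩ : ∃ a c : ℤ, 0 < a ∧ a ^ 2 ≤ n ∧ c ^ 2 ≤ n ∧
      (n : ℤ) ∣ a * t - c := by
    rcases lt_or_gt_of_ne ha with h | h
    · refine ⟨-((x : ℕ) - (x' : ℕ) : ℤ), -((y : ℕ) - (y' : ℕ) : ℤ), by omega,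
        hsq _ (by omega) (by omega), hsq _ (by omega) (by omega), ?_⟩
      rw [← dvd_neg] at hdvd
      have e : ∀ u v : ℤ, -u * t - -v = -(u * t - v) := fun u v => by ring
      rwa [e]
    · exact ⟨_, _, h, hsq _ (by omega) (by omega), hsq _ (by omega) (by omega), hdvd⟩
  -- The gcd of a and m also divides c = at − nm; dividing by it keeps the vector short.
  have hg : 0 < Int.gcd a m := Int.gcd_pos_of_ne_zero_left _ ha0.ne'
  obtain ⟨a', ha'⟩ := Int.gcd_dvd_left a m
  obtain ⟨m', hm'⟩ := Int.gcd_dvd_right a m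
  have hco := Int.isCoprime_iff_gcd_eq_one.2 (Int.gcd_ediv_gcd_ediv_gcd hg)
  set g : ℤ := (Int.gcd a m : ℤ) with hgdef
  have hg0 : 0 < g := Int.natCast_pos.2 hg
  have e1 : a / g = a' := by
    conv_lhs => rw [ha']
    exact Int.mul_ediv_cancel_left _ hg0.ne'
  have e2 : m / g = m' := by
    conv_lhs => rw [hm']
    exact Int.mul_ediv_cancel_left _ hg0.ne'
  rw [e1, e2] at hco
  have hc : c = g * (a' * t - n * m') := by linear_combination t * ha' - n * hm' - hm
  have hsm : ∀ d : ℤ, (g * d) ^ 2 ≤ n → d ^ 2 ≤ n := by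
    intro d hd
    have : d ^ 2 ≤ (g * d) ^ 2 := by
      have : 1 ≤ g ^ 2 := by nlinarith
      nlinarith [sq_nonneg d]
    linarith
  refine ⟨a', a' * t - n * m', m', ?_, hsm _ (ha' ▸ ha2), hsm _ (hc ▸ hc2), by ring, hco⟩
  by_contra! hle
  nlinarith

/-- In the row `a y - c x = n j` of the lattice, any `L` consecutive points contain one whose first
coordinate is prime to `n`. -/
theorem exists_coprime_in_row {n L : ℕ} {a b j : ℤ} (hn : n ≠ 0) (hab : IsCoprime a b)
    (hL : Sieved (n.primeFactors \ n.primeFactors.filter fun p => (p : ℤ) ∣ a) L)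
    (hj : ∀ p ∈ n.primeFactors, (p : ℤ) ∣ a → ¬ (p : ℤ) ∣ j) (i₀ : ℤ) :
    ∃ i, i₀ ≤ i ∧ i < i₀ + L ∧ IsCoprime (a * i + b * j) n := by
  obtain ⟨i, h1, h2, h3⟩ := hL a (b * j) (by
    intro p hp hd
    simp only [Finset.mem_sdiff, Finset.mem_filter, not_and] at hp
    exact hp.2 hp.1 hd) i₀
  refine ⟨i, h1, h2, ?_⟩
  rw [Int.isCoprime_iff_gcd_eq_one]
  by_contra hg
  obtain ⟨p, hp, hpd⟩ := Nat.exists_prime_and_dvd hg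
  have hpx : (p : ℤ) ∣ a * i + b * j := (Int.natCast_dvd_natCast.2 hpd).trans (Int.gcd_dvd_left _ _)
  have hpn : (p : ℤ) ∣ n := (Int.natCast_dvd_natCast.2 hpd).trans (Int.gcd_dvd_right _ _)
  have hpK : p ∈ n.primeFactors := Nat.mem_primeFactors.2 ⟨hp, by exact_mod_cast hpn, hn⟩
  have hpp := Nat.prime_iff_prime_int.1 hp
  by_cases hpa : (p : ℤ) ∣ a
  · have hbj : (p : ℤ) ∣ b * j := (dvd_add_right (hpa.mul_right i)).1 hpx
    rcases hpp.dvd_or_dvd hbj with h | h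
    · exact hpp.not_isUnit (hab.isUnit_of_dvd' hpa h)
    · exact hj p hpK hpa h
  · refine h3 p ?_ hpx
    simp only [Finset.mem_sdiff, Finset.mem_filter, not_and]
    exact ⟨hpK, fun _ => hpa⟩

section Rows

variable {n L : ℕ} {t a c m j : ℤ}

/-- If αa + βm = 1, then (β, tβ + nα) completes (a, c) to a basis of determinant n, so row j
consists of i(a, c) + j(β, tβ + nα). Starting the window at −⌊βj/a⌋ puts x between 0 and aL. -/
theorem exists_row_point_fst (hn : n ≠ 0) (hm : a * t - c = n * m) (ham : IsCoprime a m)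
    (hL : Sieved (n.primeFactors \ n.primeFactors.filter fun p => (p : ℤ) ∣ a) L)
    (hj : ∀ p ∈ n.primeFactors, (p : ℤ) ∣ a → ¬ (p : ℤ) ∣ j) (ha : 0 < a) :
    ∃ x y : ℤ, IsCoprime x n ∧ (n : ℤ) ∣ y - t * x ∧ a * y - c * x = n * j ∧ 0 ≤ x ∧ x ≤ a * L := by
  obtain ⟨α, β, hαβ⟩ := ham
  obtain ⟨i, hi0, hi1, hi2⟩ := exists_coprime_in_row (b := β) hn ⟨α, m, by linarith⟩ hL hj
    (-(β * j / a))
  have h1 := Int.mul_ediv_add_emod (β * j) a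
  have h2 := Int.emod_nonneg (β * j) ha.ne'
  have h3 := Int.emod_lt_of_pos (β * j) ha
  refine ⟨a * i + β * j, t * (a * i + β * j) - n * (m * i - α * j), hi2, ⟨-(m * i - α * j), by ring⟩,
    ?_, ?_, ?_⟩
  · linear_combination (a * i + β * j) * hm + n * j * hαβ
  · nlinarith
  · nlinarith

/-- The same row, with the window placed so as to control y = ci + dj; the sign of a is free. -/
theorem exists_row_point_snd (hn : n ≠ 0) (hm : a * t - c = n * m) (ham : IsCoprime a m)
    (hL : Sieved (n.primeFactors \ n.primeFactors.filter fun p => (p : ℤ) ∣ a) L)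
    (hj : ∀ p ∈ n.primeFactors, (p : ℤ) ∣ a → ¬ (p : ℤ) ∣ j) (hc : 0 < c) :
    ∃ x y : ℤ, IsCoprime x n ∧ (n : ℤ) ∣ y - t * x ∧ a * y - c * x = n * j ∧ 0 ≤ y ∧ y ≤ c * L := by
  obtain ⟨α, β, hαβ⟩ := ham
  set d := t * β + n * α with hd
  obtain ⟨i, hi0, hi1, hi2⟩ := exists_coprime_in_row (b := β) hn ⟨α, m, by linarith⟩ hL hj
    (-(d * j / c))
  have h1 := Int.mul_ediv_add_emod (d * j) c
  have h2 := Int.emod_nonneg (d * j) hc.ne'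
  have h3 := Int.emod_lt_of_pos (d * j) hc
  have hy : t * (a * i + β * j) - n * (m * i - α * j) = c * i + d * j := by
    rw [hd]; linear_combination i * hm
  refine ⟨a * i + β * j, t * (a * i + β * j) - n * (m * i - α * j), hi2, ⟨-(m * i - α * j), by ring⟩,
    ?_, ?_, ?_⟩
  · linear_combination (a * i + β * j) * hm + n * j * hαβ
  · rw [hy]; nlinarith
  · rw [hy]; nlinarith

end Rows

/-! ### Fitting a row into the triangle. -/

/-- The choice of a row when the short vector has coordinates of opposite signs. -/
theorem exists_row_index {n q L : ℕ} {A μ : ℤ} (hq : 2 ≤ q) (hn : (2 * q * L + 2) ^ 2 ≤ n)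
    (hn100 : 100 ≤ n) (hμ0 : 0 ≤ μ) (hμA : μ ≤ A) (hA : A ^ 2 ≤ n) (h : 2 ≤ μ ∨ 3 ≤ A) :
    ∃ e : ℕ, μ * (A * L) ≤ n * (q : ℤ) ^ e ∧
      2 * n * (q : ℤ) ^ e + 2 * (A - μ) * (A * L) ≤ A * n := by
  have hn' : (2 * q * L + 2 : ℤ) ^ 2 ≤ n := by exact_mod_cast hn
  have hn100' : (100 : ℤ) ≤ n := by exact_mod_cast hn100
  have hq' : (2 : ℤ) ≤ q := by exact_mod_cast hq
  have hL0 : (0 : ℤ) ≤ L := by positivity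
  have hqL0 : (0 : ℤ) ≤ q * L := by positivity
  have hqL : 2 * q * L * A ≤ (n : ℤ) := by
    have h1 : (2 * q * L : ℤ) ^ 2 ≤ n := by nlinarith
    refine abs_le_of_sq_le_sq' ?_ (by linarith) |>.2
    calc (2 * q * L * A : ℤ) ^ 2 = (2 * q * L : ℤ) ^ 2 * A ^ 2 := by ring
      _ ≤ (n : ℤ) * n := by gcongr
      _ = (n : ℤ) ^ 2 := by ring
  have hA0 : 0 ≤ A := hμ0.trans hμA
  have hAL0 : 0 ≤ A * L := by positivity
  have hAL : 4 * (A * L) ≤ n := by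
    have : 2 * (A * L) ≤ q * (A * L) := by gcongr
    nlinarith
  by_cases hμ2 : 2 ≤ μ
  · obtain ⟨ν, rfl⟩ := Int.eq_ofNat_of_zero_le hμ0
    have hν : 2 ≤ ν := by exact_mod_cast hμ2
    have h1 := Nat.pow_log_le_self q (x := ν / 2) (by omega)
    have h2 := Nat.lt_pow_succ_log_self (b := q) (by omega) (ν / 2)
    -- q^e is the largest power with 2q^e ≤ μ. Maximality gives μ < 2q^(e+1), which with 2qLA ≤ n
    -- yields the first bound; 2q^e ≤ μ yields the second.
    set e := Nat.log q (ν / 2) with he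
    refine ⟨e, ?_, ?_⟩
    · have h3 : ν < 2 * (q * q ^ e) := by
        rw [pow_succ] at h2
        have : q ^ e * q = q * q ^ e := mul_comm _ _
        omega
      have h4 : (ν : ℤ) ≤ 2 * (q * (q : ℤ) ^ e) := by exact_mod_cast h3.le
      calc (ν : ℤ) * (A * L) ≤ 2 * (q * (q : ℤ) ^ e) * (A * L) := by gcongr
        _ = 2 * q * L * A * (q : ℤ) ^ e := by ring
        _ ≤ n * (q : ℤ) ^ e := by gcongr
    · have h3 : 2 * q ^ e ≤ ν := by omega
      have h4 : 2 * (q : ℤ) ^ e ≤ ν := by exact_mod_cast h3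
      have h5 : 2 * (A - ν) * (A * L) ≤ (A - ν) * n := by nlinarith
      nlinarith
  · have hA3 : 3 ≤ A := h.resolve_left hμ2
    refine ⟨0, ?_, ?_⟩
    · rw [pow_zero, mul_one]
      nlinarith
    · rw [pow_zero, mul_one]
      have h1 : 2 * (A - μ) * (A * L) ≤ 2 * A * (A * L) := by nlinarith
      -- For A ≥ 4 the bound 4AL ≤ n is enough; A = 3 needs the quadratic bound on L.
      rcases hA3.eq_or_lt with rfl | hA4
      · have h2 : 4 * (L : ℤ) ≤ 2 * q * L := by nlinarith
        nlinarith
      · nlinarith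

/-- With s = 2qL + 2 it suffices that A²(s − 2) ≤ n(A − 2). For A ≥ s use A² ≤ n; for A ≤ s use s² ≤
n and s²(A − 2) − A²(s − 2) = (s − A)((A − 2)(s − 2) − 4). This is where the summand 2 in s is
needed. -/
theorem row_one_fits {n q L : ℕ} {A : ℤ} (hq : 2 ≤ q) (hn : (2 * q * L + 2) ^ 2 ≤ n)
    (hA : A ^ 2 ≤ n) (hA3 : 3 ≤ A) : 2 * n + 4 * A * (A * L) ≤ A * n := by
  set s : ℤ := 2 * q * L + 2 with hs
  have hn' : s ^ 2 ≤ n := by rw [hs]; exact_mod_cast hn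
  have hq' : (2 : ℤ) ≤ q := by exact_mod_cast hq
  rcases Nat.eq_zero_or_pos L with rfl | hL
  · push_cast
    nlinarith [Int.natCast_nonneg n]
  have hL1 : (1 : ℤ) ≤ L := by exact_mod_cast hL
  have hsL : 4 * (L : ℤ) + 2 ≤ s := by rw [hs]; nlinarith
  have key : A ^ 2 * (s - 2) ≤ n * (A - 2) := by
    rcases le_total s A with h | h
    · calc A ^ 2 * (s - 2) ≤ n * (s - 2) := by gcongr; linarith
        _ ≤ n * (A - 2) := by gcongr
    · refine le_trans ?_ (mul_le_mul_of_nonneg_right hn' (by linarith))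
      have h1 : 4 ≤ (A - 2) * (s - 2) := by nlinarith
      nlinarith [mul_nonneg (sub_nonneg.2 h) (sub_nonneg.2 h1)]
  nlinarith [sq_nonneg A]

/-- For `n` in the range of the sieve, the lattice `y ≡ t x mod n` has a point in the triangle
`0 ≤ x`, `0 ≤ y`, `2 (x + y) ≤ n` with `x` prime to `n`, unless `t` is exceptional. -/
theorem exists_point_in_triangle {n : ℕ} (hn : SieveRange n) {t : ℤ} (ht : ¬ (n : ℤ) ∣ t)
    (ht2 : ¬ (n : ℤ) ∣ 2 * t) :
    (∃ x y : ℤ, IsCoprime x n ∧ (n : ℤ) ∣ y - t * x ∧ 0 ≤ x ∧ 0 ≤ y ∧ 2 * (x + y) ≤ n) ∨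
      (n : ℤ) ∣ t + 1 ∨ (n : ℤ) ∣ t + 2 ∨ (n : ℤ) ∣ 2 * t + 1 ∨
      ((n : ℤ) ∣ 2 * (t - 1) ∧ ¬ (n : ℤ) ∣ t - 1) := by
  have hn100 := hn.base
  have hn100' : (100 : ℤ) ≤ n := by exact_mod_cast hn100
  have hn0 : n ≠ 0 := by omega
  obtain ⟨a, c, m, ha0, ha2, hc2, hm, ham⟩ := exists_short_vector (by omega : 2 ≤ n) t
  set K := n.primeFactors.filter fun p : ℕ => (p : ℤ) ∣ a with hK
  obtain ⟨q, hq⟩ := exists_leastPrimeNotMem (n := n) (K := K) (Finset.filter_subset _ _)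
  obtain ⟨L, hL, hLn⟩ := hq.exists_window hn
  have hq2 : 2 ≤ q := hq.prime.two_le
  have hjq : ∀ e : ℕ, ∀ p ∈ n.primeFactors, (p : ℤ) ∣ a → ¬ (p : ℤ) ∣ (q : ℤ) ^ e := by
    intro e p hp hpa hd
    have hpp := Nat.prime_of_mem_primeFactors hp
    have h1 : p ∣ q := hpp.dvd_of_dvd_pow (by exact_mod_cast hd)
    have h2 := (Nat.prime_dvd_prime_iff_eq hpp hq.prime).1 h1
    exact hq.notMem (h2 ▸ Finset.mem_filter.2 ⟨hp, hpa⟩)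
  have hj1 : ∀ p ∈ n.primeFactors, (p : ℤ) ∣ a → ¬ (p : ℤ) ∣ 1 := by simpa using hjq 0
  rcases le_or_gt c 0 with hc | hc
  · obtain ⟨c', rfl⟩ : ∃ c', c = -c' := ⟨-c, by ring⟩
    have hc0 : 0 ≤ c' := by linarith
    by_cases hex : (2 ≤ a ∧ 2 ≤ c') ∨ 3 ≤ a ∨ 3 ≤ c'
    · left
      rcases le_total c' a with hca | hca
      -- On this row ay = nq^e − c'x and a(x + y) = nq^e + (a − c')x, so the two bounds say y ≥ 0
      -- and 2(x + y) ≤ n.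
      · obtain ⟨e, he1, he2⟩ := exists_row_index hq2 hLn hn100 hc0 hca ha2 (by omega)
        obtain ⟨x, y, hx, hxy, hrow, hx0, hxL⟩ := exists_row_point_fst hn0 hm ham hL (hjq e) ha0
        have hcx : c' * x ≤ c' * (a * L) := by gcongr
        have hcx2 : (a - c') * x ≤ (a - c') * (a * L) :=
          mul_le_mul_of_nonneg_left hxL (by linarith)
        refine ⟨x, y, hx, hxy, hx0, ?_, ?_⟩
        · refine nonneg_of_mul_nonneg_right (a := a) ?_ ha0
          linarith
        · refine le_of_mul_le_mul_left (a := a) ?_ ha0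
          linarith
      · have hc1 : 0 < c' := ha0.trans_le hca
        obtain ⟨e, he1, he2⟩ := exists_row_index hq2 hLn hn100 ha0.le hca
          (by simpa using hc2) (by omega)
        obtain ⟨x, y, hx, hxy, hrow, hy0, hyL⟩ := exists_row_point_snd (t := t) (a := -a) (c := c') (m := -m)
          (j := -(q : ℤ) ^ e) hn0 (by linarith) ham.neg_neg
          (by simpa only [dvd_neg] using hL) (by simpa only [dvd_neg] using hjq e) hc1
        have hcx : a * y ≤ a * (c' * L) := by gcongr
        have hcx2 : (c' - a) * y ≤ (c' - a) * (c' * L) :=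
          mul_le_mul_of_nonneg_left hyL (by linarith)
        refine ⟨x, y, hx, hxy, ?_, hy0, ?_⟩
        · refine nonneg_of_mul_nonneg_right (a := c') ?_ hc1
          linarith
        · refine le_of_mul_le_mul_left (a := c') ?_ hc1
          linarith
    · right
      -- The remaining vectors force t ≡ 0, −1, −2 or 2t ≡ 0, −1 mod n.
      have ha3 : a = 1 ∨ a = 2 := by omega
      have hc3 : c' = 0 ∨ c' = 1 ∨ c' = 2 := by omega
      rcases ha3 with rfl | rfl <;> rcases hc3 with rfl | rfl | rfl
      · exact absurd ⟨m, by linarith⟩ ht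
      · exact Or.inl ⟨m, by linarith⟩
      · exact Or.inr (Or.inl ⟨m, by linarith⟩)
      · exact absurd ⟨m, by linarith⟩ ht2
      · exact Or.inr (Or.inr (Or.inl ⟨m, by linarith⟩))
      · omega
  -- Here (a, c) lies in the triangle itself, as 4a, 4c ≤ n; only coprimality of a can fail, and
  -- then the row j = 1 or j = −1 is used.
  · by_cases han : IsCoprime a n
    · left
      have h4 : ∀ d : ℤ, d ^ 2 ≤ n → 4 * d ≤ n := by
        intro d hd
        refine abs_le_of_sq_le_sq' ?_ (by linarith) |>.2
        nlinarith
      have h5 := h4 a ha2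
      have h6 := h4 c hc2
      exact ⟨a, c, han, ⟨-m, by linarith⟩, ha0.le, hc.le, by linarith⟩
    by_cases hex : 3 ≤ a ∨ 3 ≤ c
    · left
      rcases le_total c a with hca | hca
      · have hfit := row_one_fits hq2 hLn ha2 (by omega)
        obtain ⟨x, y, hx, hxy, hrow, hx0, hxL⟩ := exists_row_point_fst hn0 hm ham hL hj1 ha0
        have hcx0 : 0 ≤ c * x := by positivity
        have h1 : (a + c) * x ≤ 2 * a * (a * L) := by
          calc (a + c) * x ≤ (2 * a) * x := mul_le_mul_of_nonneg_right (by linarith) hx0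
            _ ≤ 2 * a * (a * L) := by gcongr
        refine ⟨x, y, hx, hxy, hx0, ?_, ?_⟩
        · refine nonneg_of_mul_nonneg_right (a := a) ?_ ha0
          linarith
        · refine le_of_mul_le_mul_left (a := a) ?_ ha0
          linarith
      · have hfit := row_one_fits hq2 hLn hc2 (by omega)
        obtain ⟨x, y, hx, hxy, hrow, hy0, hyL⟩ := exists_row_point_snd (j := -1) hn0 hm ham hL
          (by simpa only [dvd_neg] using hj1) hc
        have hcx0 : 0 ≤ a * y := by positivity
        have h1 : (a + c) * y ≤ 2 * c * (c * L) := by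
          calc (a + c) * y ≤ (2 * c) * y := mul_le_mul_of_nonneg_right (by linarith) hy0
            _ ≤ 2 * c * (c * L) := by gcongr
        refine ⟨x, y, hx, hxy, ?_, hy0, ?_⟩
        · refine nonneg_of_mul_nonneg_right (a := c) ?_ hc
          linarith
        · refine le_of_mul_le_mul_left (a := c) ?_ hc
          linarith
    · have ha3 : a = 1 ∨ a = 2 := by omega
      have hc3 : c = 1 ∨ c = 2 := by omega
      rcases ha3 with rfl | rfl
      · exact absurd isCoprime_one_left han
      have heven : (2 : ℤ) ∣ n := by
        by_contra h
        exact han ((Int.prime_two.coprime_iff_not_dvd).2 h)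
      rcases hc3 with rfl | rfl
      · obtain ⟨k, hk⟩ := heven
        rw [hk] at hm
        have : (2 : ℤ) * (t - k * m) = 1 := by linear_combination hm
        omega
      · by_cases h1 : (n : ℤ) ∣ t - 1
        · left
          refine ⟨1, 1, isCoprime_one_left, ?_, by norm_num, by norm_num, by linarith⟩
          have : (1 : ℤ) - t * 1 = -(t - 1) := by ring
          rw [this, dvd_neg]
          exact h1
        · exact Or.inr (Or.inr (Or.inr (Or.inr ⟨⟨m, by linarith⟩, h1⟩)))

/-! ### Computation for small n. -/

/-- The residues `t` modulo `n` that are allowed by the theorem or excluded by its hypotheses. -/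
def isExceptional (n t : ℕ) : Bool :=
  (t + 1).beq n || (t + 2).beq n || (2 * t + 1).beq n || (2 * t + 1).beq (2 * n) ||
    (2 * t).beq n || (2 * t).beq (n + 2)

/-- `t` is exceptional, or some unit `p` puts `(p, p t mod n)` into the triangle. -/
def Covered (n t : ℕ) : Prop :=
  isExceptional n t = true ∨ ∃ p : ℕ, p.Coprime n ∧ p + p * t % n ≤ n / 2

/-- Finds the first `p` in the list that works for `t`, and passes the largest residue for which it
works with the same quotient to `next`. -/
def firstHit (n t : ℕ) (next : ℕ → Bool) : List ℕ → Bool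
  | [] => false
  | p :: l => bif (p + p * t % n).ble (n / 2) then next ((n * (p * t / n) + (n / 2 - p)) / p)
      else firstHit n t next l

def scanStep (n : ℕ) (l : List ℕ) (next : ℕ → Bool) (t : ℕ) : Bool :=
  bif n.ble t then true else bif isExceptional n t then next t else firstHit n t next l

/-- Checks that all residues beyond `t` are covered. -/
def scanResidues (n : ℕ) (l : List ℕ) : ℕ → ℕ → Bool
  | 0, _ => false
  | fuel + 1, 0 => scanStep n l (scanResidues n l fuel) 1
  | fuel + 1, t + 1 => scanStep n l (scanResidues n l fuel) t.succ.succ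

/-- Applies `f` to the list of integers in `[1, k]` prime to `n`, followed by the given list. -/
def withCoprimes (n : ℕ) (f : List ℕ → Bool) : ℕ → List ℕ → Bool
  | 0, l => f l
  | k + 1, l => bif ((k + 1).gcd n).beq 1 then withCoprimes n f k ((k + 1) :: l)
      else withCoprimes n f k l

/-- Only p ≤ n/2 can satisfy the inequality, and every step of the scan raises the residue, so fuel
n suffices. -/
def checkModulus (n : ℕ) : Bool := withCoprimes n (fun l => scanResidues n l n 0) (n / 2) []

/-- At least `k` members of the list divide `n`. -/
def hasDivisors (n : ℕ) : List ℕ → ℕ → Bool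
  | _, 0 => true
  | [], _ + 1 => false
  | p :: l, k + 1 => bif (n % p).beq 0 then hasDivisors n l k else hasDivisors n l (k + 1)

def checkRange (f : ℕ → Bool) (lo : ℕ) : ℕ → Bool
  | 0 => true
  | k + 1 => bif f (lo + k) then checkRange f lo k else false

/-- Let Q = ⌊pt/n⌋. For u ≥ t the residue of pu is at most pu − nQ, so p keeps working as long as pu
≤ nQ + n/2 − p. -/
theorem covered_of_firstHit {n t : ℕ} {next : ℕ → Bool} {l : List ℕ}
    (hl : ∀ p ∈ l, p.Coprime n ∧ 0 < p) (h : firstHit n t next l = true) :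
    ∃ t', (∀ u, t ≤ u → u ≤ t' → Covered n u) ∧ next t' = true := by
  induction l with
  | nil => simp [firstHit] at h
  | cons p l ih =>
    rw [firstHit] at h
    rcases hb : (p + p * t % n).ble (n / 2) with _ | _
    · rw [hb, cond_false] at h
      exact ih (fun p hp => hl p (List.mem_cons_of_mem _ hp)) h
    · rw [hb, cond_true] at h
      obtain ⟨hpn, hp0⟩ := hl p List.mem_cons_self
      refine ⟨_, fun u h1 h2 => Or.inr ⟨p, hpn, ?_⟩, h⟩
      have hb' := Nat.le_of_ble_eq_true hb
      rw [Nat.le_div_iff_mul_le hp0] at h2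
      have h3 : p * t ≤ p * u := Nat.mul_le_mul_left _ h1
      have h4 := Nat.div_add_mod (p * t) n
      have h5 : p * u = (p * u - n * (p * t / n)) + n * (p * t / n) := by omega
      have h6 : p * u % n ≤ p * u - n * (p * t / n) := by
        conv_lhs => rw [h5, Nat.add_mul_mod_self_left]
        exact Nat.mod_le _ _
      have h7 : u * p = p * u := mul_comm _ _
      omega

theorem covered_of_scanStep {n t : ℕ} {next : ℕ → Bool} {l : List ℕ}
    (hl : ∀ p ∈ l, p.Coprime n ∧ 0 < p) (h : scanStep n l next t = true)
    (hnext : ∀ t', next t' = true → ∀ u, t' < u → u < n → Covered n u) :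
    ∀ u, t ≤ u → u < n → Covered n u := by
  rw [scanStep] at h
  intro u h1 h2
  rcases hb : n.ble t with _ | _
  · rw [hb, cond_false] at h
    rcases he : isExceptional n t with _ | _
    · rw [he, cond_false] at h
      obtain ⟨t', h3, h4⟩ := covered_of_firstHit hl h
      rcases le_or_gt u t' with h5 | h5
      · exact h3 u h1 h5
      · exact hnext t' h4 u h5 h2
    · rw [he, cond_true] at h
      rcases h1.eq_or_lt with rfl | h5
      · exact Or.inl he
      · exact hnext t h u h5 h2
  · have := Nat.le_of_ble_eq_true hb
    omega

theorem covered_of_scanResidues {n : ℕ} {l : List ℕ} (hl : ∀ p ∈ l, p.Coprime n ∧ 0 < p)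
    (fuel : ℕ) : ∀ t, scanResidues n l fuel t = true → ∀ u, t < u → u < n → Covered n u := by
  induction fuel with
  | zero => intro t h; simp [scanResidues] at h
  | succ fuel ih =>
    intro t h u h1 h2
    cases t with
    | zero => exact covered_of_scanStep hl h ih u h1 h2
    | succ t => exact covered_of_scanStep hl h ih u h1 h2

theorem exists_of_withCoprimes {n : ℕ} {f : List ℕ → Bool} (k : ℕ) :
    ∀ l : List ℕ, (∀ p ∈ l, p.Coprime n ∧ 0 < p) → withCoprimes n f k l = true →
      ∃ l', (∀ p ∈ l', p.Coprime n ∧ 0 < p) ∧ f l' = true := by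
  induction k with
  | zero => intro l hl h; exact ⟨l, hl, h⟩
  | succ k ih =>
    intro l hl h
    rw [withCoprimes] at h
    rcases hb : ((k + 1).gcd n).beq 1 with _ | _
    · rw [hb, cond_false] at h
      exact ih l hl h
    · rw [hb, cond_true] at h
      refine ih _ (fun p hp => ?_) h
      rcases List.mem_cons.1 hp with rfl | hp
      · exact ⟨Nat.eq_of_beq_eq_true hb, Nat.succ_pos k⟩
      · exact hl p hp

theorem covered_of_checkModulus {n : ℕ} (h : checkModulus n = true) {t : ℕ} (ht : 0 < t)
    (htn : t < n) : Covered n t := by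
  obtain ⟨l, hl, hs⟩ := exists_of_withCoprimes _ _ (by simp) h
  exact covered_of_scanResidues hl _ _ hs t ht htn

theorem of_checkRange {f : ℕ → Bool} {lo k : ℕ} (h : checkRange f lo k = true) {n : ℕ}
    (h1 : lo ≤ n) (h2 : n < lo + k) : f n = true := by
  induction k with
  | zero => omega
  | succ k ih =>
    rw [checkRange] at h
    rcases hb : f (lo + k) with _ | _
    · rw [hb, cond_false] at h
      exact absurd h (by decide)
    · rw [hb, cond_true] at h
      rcases Nat.lt_succ_iff_lt_or_eq.1 h2 with h3 | h3
      · exact ih h h3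
      · rwa [h3]

theorem hasDivisors_of_card_le {n : ℕ} (l : List ℕ) :
    ∀ (k : ℕ) (S : Finset ℕ), (∀ p ∈ S, p ∈ l ∧ p ∣ n) → k ≤ S.card → hasDivisors n l k = true := by
  induction l with
  | nil =>
    intro k S hS hk
    have : S = ∅ := Finset.eq_empty_of_forall_notMem fun p hp => by simpa using (hS p hp).1
    rw [this, Finset.card_empty] at hk
    obtain rfl : k = 0 := by omega
    rfl
  | cons p l ih =>
    intro k S hS hk
    cases k with
    | zero => rfl
    | succ k =>
      rw [hasDivisors]
      have herase : ∀ q ∈ S.erase p, q ∈ l ∧ q ∣ n := by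
        intro q hq
        obtain ⟨h1, h2⟩ := Finset.mem_erase.1 hq
        obtain ⟨h3, h4⟩ := hS q h2
        exact ⟨(List.mem_cons.1 h3).resolve_left h1, h4⟩
      rcases hb : (n % p).beq 0 with _ | _
      · rw [cond_false]
        have hp : p ∉ S := by
          intro hp
          rw [Nat.mod_eq_zero_of_dvd (hS p hp).2] at hb
          exact absurd hb (by decide)
        rw [Finset.erase_eq_of_notMem hp] at herase
        exact ih _ S herase hk
      · rw [cond_true]
        refine ih k _ herase ?_
        have := Finset.pred_card_le_card_erase (s := S) (a := p)
        omega

/-- The primes of n other than p multiply to at least the product of the first k primes, which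
forces p < B. Thus a short list of primes detects every n with more than k prime factors in the
range. -/
theorem hasDivisors_of_lt {n k B : ℕ} {l : List ℕ} (hn : n ≠ 0)
    (hl : ∀ p < B, p.Prime → p ∈ l) (hk : k + 1 ≤ n.primeFactors.card)
    (hB : n < B * ∏ i ∈ Finset.range k, Nat.nth Nat.Prime i) :
    hasDivisors n l (k + 1) = true := by
  refine hasDivisors_of_card_le l _ n.primeFactors (fun p hp => ⟨hl p ?_ ?_, ?_⟩) hk
  · have h1 : ∏ i ∈ Finset.range k, Nat.nth Nat.Prime i ≤ ∏ q ∈ n.primeFactors.erase p, q :=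
      prod_nth_prime_le
        (fun q hq => Nat.prime_of_mem_primeFactors (Finset.mem_of_mem_erase hq))
        (by rw [Finset.card_erase_of_mem hp]; omega)
    have h2 : p * ∏ q ∈ n.primeFactors.erase p, q ≤ n := by
      rw [Finset.mul_prod_erase n.primeFactors (fun q => q) hp]
      exact Nat.le_of_dvd (Nat.pos_of_ne_zero hn) (Nat.prod_primeFactors_dvd n)
    have h3 := (Nat.mul_le_mul_left p h1).trans h2
    exact lt_of_mul_lt_mul_right (h3.trans_lt hB) (Nat.zero_le _)
  · exact Nat.prime_of_mem_primeFactors hp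
  · exact Nat.dvd_of_mem_primeFactors hp

theorem checkRange_small : checkRange checkModulus 79 245 = true := by decide +kernel

def primesBelow113 : List ℕ :=
  [2, 3, 5, 7, 11, 13, 17, 19, 23, 29, 31, 37, 41, 43, 47, 53, 59, 61, 67, 71, 73, 79, 83, 89, 97,
    101, 103, 107, 109]

def primesBelow59 : List ℕ := [2, 3, 5, 7, 11, 13, 17, 19, 23, 29, 31, 37, 41, 43, 47, 53]

def primesBelow27 : List ℕ := [2, 3, 5, 7, 11, 13, 17, 19, 23]

theorem checkRange_three : checkRange
    (fun n => bif hasDivisors n primesBelow113 3 then checkModulus n else true) 324 352 = true := by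
  decide +kernel

theorem checkRange_four : checkRange
    (fun n => bif hasDivisors n primesBelow59 4 then checkModulus n else true) 676 1088 = true := by
  decide +kernel

theorem checkRange_five : checkRange
    (fun n => bif hasDivisors n primesBelow27 5 then checkModulus n else true) 1764 3712 = true := by
  decide +kernel

theorem mem_primesBelow113 : ∀ p < 113, p.Prime → p ∈ primesBelow113 := by decide +kernel

theorem mem_primesBelow59 : ∀ p < 59, p.Prime → p ∈ primesBelow59 := by decide +kernel

theorem mem_primesBelow27 : ∀ p < 27, p.Prime → p ∈ primesBelow27 := by decide +kernel

theorem sieveRange_or_checkModulus {n : ℕ} (hn : 78 < n) :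
    SieveRange n ∨ checkModulus n = true := by
  by_cases h1 : n < 324
  · exact Or.inr (of_checkRange checkRange_small hn (by omega))
  by_cases h3 : 3 ≤ n.primeFactors.card ∧ n < 676
  · right
    have := of_checkRange checkRange_three (n := n) (by omega) (by omega)
    rwa [hasDivisors_of_lt (k := 2) (by omega) mem_primesBelow113 h3.1, cond_true] at this
    simp only [Finset.prod_range_succ, Finset.prod_range_zero, Nat.nth_prime_zero_eq_two,
      Nat.nth_prime_one_eq_three]
    omega
  by_cases h4 : 4 ≤ n.primeFactors.card ∧ n < 1764
  · right
    have := of_checkRange checkRange_four (n := n) (by omega) (by omega)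
    rwa [hasDivisors_of_lt (k := 3) (by omega) mem_primesBelow59 h4.1, cond_true] at this
    simp only [Finset.prod_range_succ, Finset.prod_range_zero, Nat.nth_prime_zero_eq_two,
      Nat.nth_prime_one_eq_three, Nat.nth_prime_two_eq_five]
    omega
  by_cases h5 : 5 ≤ n.primeFactors.card ∧ n < 5476
  · right
    have := of_checkRange checkRange_five (n := n) (by omega) (by omega)
    rwa [hasDivisors_of_lt (k := 4) (by omega) mem_primesBelow27 h5.1, cond_true] at this
    simp only [Finset.prod_range_succ, Finset.prod_range_zero, Nat.nth_prime_zero_eq_two,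
      Nat.nth_prime_one_eq_three, Nat.nth_prime_two_eq_five, Nat.nth_prime_three_eq_seven]
    omega
  exact Or.inl ⟨by omega, by omega, by omega, by omega, by omega⟩

/-! ### Both ranges combined, and the reduction to s = 1. -/

theorem exists_point_or_exceptional {n t : ℕ} (hn : 78 < n) (ht : 0 < t) (htn : t < n)
    (ht2 : 2 * t ≠ n) :
    (∃ x y : ℤ, IsCoprime x n ∧ (n : ℤ) ∣ y - t * x ∧ 0 ≤ x ∧ 0 ≤ y ∧ 2 * (x + y) ≤ n) ∨
      (n : ℤ) ∣ t + 1 ∨ (n : ℤ) ∣ t + 2 ∨ (n : ℤ) ∣ 2 * t + 1 ∨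
      ((n : ℤ) ∣ 2 * (t - 1) ∧ ¬ (n : ℤ) ∣ t - 1) := by
  rcases sieveRange_or_checkModulus hn with h | h
  · refine exists_point_in_triangle h (fun hd => ?_) (fun hd => ?_)
    · have := Nat.le_of_dvd ht (by exact_mod_cast hd)
      omega
    · have hd' : n ∣ 2 * t := by exact_mod_cast hd
      obtain ⟨k, hk⟩ := hd'
      rcases Nat.lt_or_ge k 2 with h1 | h1
      · interval_cases k <;> omega
      · have : n * 2 ≤ n * k := Nat.mul_le_mul_left n h1
        omega
  · rcases covered_of_checkModulus h ht htn with he | ⟨p, hp, hle⟩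
    · simp only [isExceptional, Bool.or_eq_true] at he
      right
      rcases he with ((((he | he) | he) | he) | he) | he <;> replace he := Nat.eq_of_beq_eq_true he
      · exact Or.inl ⟨1, by omega⟩
      · exact Or.inr (Or.inl ⟨1, by omega⟩)
      · exact Or.inr (Or.inr (Or.inl ⟨1, by omega⟩))
      · exact Or.inr (Or.inr (Or.inl ⟨2, by omega⟩))
      · exact absurd he ht2
      · refine Or.inr (Or.inr (Or.inr ⟨⟨1, by omega⟩, fun hd => ?_⟩))
        have := Int.le_of_dvd (by omega) hd
        omega
    · refine Or.inl ⟨p, (p * t % n : ℕ), Nat.isCoprime_iff_coprime.2 hp, ?_, by positivity,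
        by positivity, by omega⟩
      have h1 := Nat.div_add_mod (p * t) n
      refine ⟨-(p * t / n : ℕ), ?_⟩
      have h2 : (n * (p * t / n : ℕ) + (p * t % n : ℕ) : ℤ) = p * t := by exact_mod_cast h1
      linear_combination h2

theorem theorem3 (n s t : ℤ) (hs : 1 ≤ s) (hsn : s < n) (ht : 1 ≤ t) (htn : t < n)
    (hns : Int.gcd n s = 1) (htn2 : 2 * t ≠ n)
    (h : ∀ p : ℤ, Int.gcd p n = 1 →
      (n : ℚ) / 2 < (((p * s) % n + (p * t) % n : ℤ) : ℚ) ∧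
        (((p * s) % n + (p * t) % n : ℤ) : ℚ) < 3 * (n : ℚ) / 2) :
    n ≤ 78 ∨ s + t = n ∨ (s + 2 * t = n ∨ s + 2 * t = 2 * n) ∨
      (2 * s + t = n ∨ 2 * s + t = 2 * n) ∨
      (Even n ∧ ((|t - s| : ℤ) : ℚ) = (n : ℚ) / 2) := by
  rcases le_or_gt n 78 with hn | hn
  · exact Or.inl hn
  right
  -- u is the inverse of s mod n, and τ below is the residue of tu.
  obtain ⟨v, u, huv⟩ := Int.isCoprime_iff_gcd_eq_one.2 hns
  have hn0 : 0 < n := by linarith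
  have hτ0 := Int.emod_nonneg (t * u) hn0.ne'
  have hτn := Int.emod_lt_of_pos (t * u) hn0
  have hτ := Int.mul_ediv_add_emod (t * u) n
  obtain ⟨τ, hτe⟩ := Int.eq_ofNat_of_zero_le hτ0
  rw [hτe] at hτ hτn
  set w := t * u / n with hw
  have hsτ : t = s * τ + n * (v * t + s * w) := by linear_combination (-s) * hτ - t * huv
  obtain ⟨N, rfl⟩ := Int.eq_ofNat_of_zero_le hn0.le
  have hlift : ∀ {α β z : ℤ}, z = s * (α * τ + β) + N * (α * (v * t + s * w)) →
      (N : ℤ) ∣ α * τ + β → (N : ℤ) ∣ z := by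
    intro α β z hz hd
    rw [hz]
    exact dvd_add (hd.mul_left s) (dvd_mul_right _ _)
  have hτpos : 0 < τ := by
    rcases Nat.eq_zero_or_pos τ with rfl | hpos
    · have hd : (N : ℤ) ∣ t := ⟨v * t + s * w, by simpa using hsτ⟩
      have := Int.le_of_dvd (by linarith) hd
      linarith
    · exact hpos
  have h2t : ¬ (N : ℤ) ∣ 2 * t := by
    rintro ⟨k, hk⟩
    have h1 : 0 < k := by by_contra! hle; nlinarith
    have h2 : k < 2 := by by_contra! hle; nlinarith
    obtain rfl : k = 1 := by omega
    exact htn2 (by linarith)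
  have hτ2 : 2 * τ ≠ N := by
    intro h2
    refine h2t (hlift (α := 2) (β := 0) (by linear_combination 2 * hsτ) ⟨1, ?_⟩)
    have : (2 * τ : ℤ) = N := by exact_mod_cast h2
    linarith
  have hmul : ∀ {k : ℤ}, 0 < (N : ℤ) * k → (N : ℤ) * k < N * 3 → k = 1 ∨ k = 2 := by
    intro k h1 h2
    have h3 := pos_of_mul_pos_right h1 hn0.le
    have h4 := lt_of_mul_lt_mul_left h2 hn0.le
    omega
  rcases exists_point_or_exceptional (by omega) hτpos (by omega) hτ2 with
    ⟨x, y, hx, ⟨k, hk⟩, hx0, hy0, hxy⟩ | hd | hd | hd | ⟨hd, hd'⟩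
  · exfalso
    have hu : IsCoprime u (N : ℤ) := ⟨s, v, by linarith⟩
    -- For p = xu the residues of ps and pt are x and y, whose sum is at most n/2.
    obtain ⟨h1, -⟩ := h (x * u) (Int.isCoprime_iff_gcd_eq_one.1 (hx.mul_left hu))
    have e1 : x * u * s % N = x := by
      have : x * u * s = x + N * (-(x * v)) := by linear_combination x * huv
      rw [this, Int.add_mul_emod_self_left]
      exact Int.emod_eq_of_lt hx0 (by linarith)
    have e2 : x * u * t % N = y := by
      have : x * u * t = y + N * (x * w - k) := by linear_combination (-x) * hτ - hk
      rw [this, Int.add_mul_emod_self_left]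
      exact Int.emod_eq_of_lt hy0 (by linarith)
    rw [e1, e2] at h1
    have h2 : (2 * (x + y) : ℚ) ≤ ((N : ℤ) : ℚ) := by exact_mod_cast hxy
    push_cast at h1 h2
    linarith
  · left
    obtain ⟨k, hk⟩ := hlift (α := 1) (β := 1) (z := s + t) (by linear_combination hsτ)
      (by simpa using hd)
    rcases hmul (k := k) (by linarith) (by linarith) with rfl | rfl <;> linarith
  · right; right; left
    obtain ⟨k, hk⟩ := hlift (α := 1) (β := 2) (z := 2 * s + t) (by linear_combination hsτ)
      (by simpa using hd)
    rcases hmul (k := k) (by linarith) (by linarith) with rfl | rfl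
    · exact Or.inl (by linarith)
    · exact Or.inr (by linarith)
  · right; left
    obtain ⟨k, hk⟩ := hlift (α := 2) (β := 1) (z := s + 2 * t) (by linear_combination 2 * hsτ) hd
    rcases hmul (k := k) (by linarith) (by linarith) with rfl | rfl
    · exact Or.inl (by linarith)
    · exact Or.inr (by linarith)
  · right; right; right
    obtain ⟨k, hk⟩ := hlift (α := 2) (β := -2) (z := 2 * (t - s)) (by linear_combination 2 * hsτ)
      (by convert hd using 1; ring)
    -- k = 0 would mean t = s, hence τ ≡ 1, which `hd'` excludes.
    have hk0 : k ≠ 0 := by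
      rintro rfl
      have hts : t = s := by linarith
      refine hd' ⟨-w - v, ?_⟩
      rw [hts] at hτ
      linear_combination hτ + huv
    have hk1 : k = 1 ∨ k = -1 := by
      have h1 : k < 2 := by by_contra! hle; nlinarith
      have h2 : -2 < k := by by_contra! hle; nlinarith
      omega
    have habs : 2 * |t - s| = N := by
      rcases hk1 with rfl | rfl
      · rw [abs_of_nonneg (by linarith)]; linarith
      · rw [abs_of_nonpos (by linarith)]; linarith
    refine ⟨⟨|t - s|, by linarith⟩, ?_⟩
    have : (2 * (|t - s| : ℤ) : ℚ) = ((N : ℤ) : ℚ) := by exact_mod_cast habs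
    linarith
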